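/- Let $\mu_0,\mu_1$ be compactly supported Borel probability measures on $\mathbb{R}^{d_0}$ and $\mathbb{R}^{d_1}$, and let $\varepsilon>0$. For $A\in\mathbb{R}^{d_0\times d_1}$ put $c_A(x,y)=-4\|x\|^2\|y\|^2-32\,x^{\top}Ay$ and $$\mathsf{OT}_{A,\varepsilon}(\mu_0,\mu_1)=\inf_{\pi\in\Pi(\mu_0,\mu_1)}\Big\{\int c_A\,d\pi+\varepsilon\,\mathsf{D}_{\mathsf{KL}}(\pi\,\|\,\mu_0\otimes\mu_1)\Big\},$$ where $\Pi(\mu_0,\mu_1)$ is the set of couplings of $\mu_0$ and $\mu_1$. This infimum is finite and is attained at a unique coupling $\pi_A$. Moreover, there are EOT potentials for $c_A$, that is, continuous functions $\varphi_0^A:\mathbb{R}^{d_0}\to\mathbb{R}$ and $\varphi_1^A:\mathbb{R}^{d_1}\to\mathbb{R}$ such that, for all $x\in\mathbb{R}^{d_0}$ and all $y\in\mathbb{R}^{d_1}$, $$\int e^{\frac{\varphi_0^A(x)+\varphi_1^A(y')-c_A(x,y')}{\varepsilon}}d\mu_1(y')=1,\qquad \int e^{\frac{\varphi_0^A(x')+\varphi_1^A(y)-c_A(x',y)}{\varepsilon}}d\mu_0(x')=1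 .$$ The function $\Phi:\mathbb{R}^{d_0\times d_1}\to\mathbb{R}$, $\Phi(A)=32\|A\|_F^2+\mathsf{OT}_{A,\varepsilon}(\mu_0,\mu_1)$, is smooth ($C^\infty$) and coercive (that is, $\Phi(A)\to+\infty$ as $\|A\|_F\to\infty$), and for all $A,B,C\in\mathbb{R}^{d_0\times d_1}$ its first and second Fréchet derivatives at $A$ are $$D\Phi_{[A]}(B)=64\,\mathrm{tr}(A^{\top}B)-32\int x^{\top}By\,d\pi_A(x,y),$$ $$D^2\Phi_{[A]}(B,C)=64\,\mathrm{tr}(B^{\top}C)+32\,\varepsilon^{-1}\int x^{\top}By\,\big(h_0(x)+h_1(y)-32\,x^{\top}Cy\big)\,d\pi_A(x,y).$$ Here, for any pair $(\varphi_0^A,\varphi_1^A)$ of EOT potentials for $c_A$, $(h_0,h_1)$ is the pair of continuous functions on $\mathrm{spt}(\mu_0)$ and $\mathrm{spt}(\mu_1)$, which exists and is unique up to replacing $(h_0,h_1)$ by $(h_0+a,h_1-a)$ with $a\in\mathbb{R}$, such that $$\int\big(h_0(x)+h_1(y)-32\,x^{\top}Cy\big)e^{\frac{\varphi_0^A(x)+\varphi_1^A(y)-c_A(x,y)}{\varepsilon}}d\mu_1(y)=0\quad\text{for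 all }x\in\mathrm{spt}(\mu_0),$$ $$\int\big(h_0(x)+h_1(y)-32\,x^{\top}Cy\big)e^{\frac{\varphi_0^A(x)+\varphi_1^A(y)-c_A(x,y)}{\varepsilon}}d\mu_0(x)=0\quad\text{for all }y\in\mathrm{spt}(\mu_1).$$ -/

import Mathlib

open MeasureTheory Filter InformationTheory
open scoped ContDiff Matrix Matrix.Norms.Frobenius

noncomputable section

/-- The bilinear form `xᵀ A y`. -/
def bilin {d₀ d₁ : ℕ} (A : Matrix (Fin d₀) (Fin d₁) ℝ)
    (x : EuclideanSpace ℝ (Fin d₀)) (y : EuclideanSpace ℝ (Fin d₁)) : ℝ :=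
  x.ofLp ⬝ᵥ (A *ᵥ y.ofLp)

/-- The cost function `c_A(x, y) = -4 ‖x‖² ‖y‖² - 32 xᵀ A y`. -/
def costA {d₀ d₁ : ℕ} (A : Matrix (Fin d₀) (Fin d₁) ℝ)
    (x : EuclideanSpace ℝ (Fin d₀)) (y : EuclideanSpace ℝ (Fin d₁)) : ℝ :=
  -4 * ‖x‖ ^ 2 * ‖y‖ ^ 2 - 32 * bilin A x y

/-- The set `Π(μ₀, μ₁)` of couplings: measures on the product with marginals `μ₀` and `μ₁`. -/
def couplings {X Y : Type*} [MeasurableSpace X] [MeasurableSpace Y]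
    (μ₀ : Measure X) (μ₁ : Measure Y) : Set (Measure (X × Y)) :=
  {π | π.map Prod.fst = μ₀ ∧ π.map Prod.snd = μ₁}

/-- The entropic transport objective `∫ c dπ + ε KL(π ‖ μ₀ ⊗ μ₁)`, with values in `(-∞, +∞]`.
It is used for costs that are integrable against every coupling (such as continuous costs with
compactly supported marginals) and for probability measures, for which `klDiv` is the usual
Kullback-Leibler divergence. -/
def eotObjective {X Y : Type*} [MeasurableSpace X] [MeasurableSpace Y]
    (μ₀ : Measure X) (μ₁ : Measure Y) (c : X → Y → ℝ) (ε : ℝ) (π : Measure (X × Y)) : EReal :=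
  ((∫ z, c z.1 z.2 ∂π : ℝ) : EReal) + (ε : EReal) * (klDiv π (μ₀.prod μ₁) : EReal)

/-- The entropic optimal transport cost, the infimum of the objective over all couplings. -/
def eotCost {X Y : Type*} [MeasurableSpace X] [MeasurableSpace Y]
    (μ₀ : Measure X) (μ₁ : Measure Y) (c : X → Y → ℝ) (ε : ℝ) : EReal :=
  ⨅ π ∈ couplings μ₀ μ₁, eotObjective μ₀ μ₁ c ε π

/-- `π` is an EOT coupling: a coupling at which the infimum is attained. -/
def IsEOTCoupling {X Y : Type*} [MeasurableSpace X] [MeasurableSpace Y]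
    (μ₀ : Measure X) (μ₁ : Measure Y) (c : X → Y → ℝ) (ε : ℝ) (π : Measure (X × Y)) : Prop :=
  π ∈ couplings μ₀ μ₁ ∧ eotObjective μ₀ μ₁ c ε π = eotCost μ₀ μ₁ c ε

/-- `(φ₀, φ₁)` is a pair of EOT potentials: continuous functions which satisfy the
Schrödinger system at all points. -/
structure IsEOTPotentials {X Y : Type*} [MeasurableSpace X] [MeasurableSpace Y]
    [TopologicalSpace X] [TopologicalSpace Y]
    (μ₀ : Measure X) (μ₁ : Measure Y) (c : X → Y → ℝ) (ε : ℝ)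
    (φ₀ : X → ℝ) (φ₁ : Y → ℝ) : Prop where
  continuous_fst : Continuous φ₀
  continuous_snd : Continuous φ₁
  system_fst : ∀ x, ∫ y, Real.exp ((φ₀ x + φ₁ y - c x y) / ε) ∂μ₁ = 1
  system_snd : ∀ y, ∫ x, Real.exp ((φ₀ x + φ₁ y - c x y) / ε) ∂μ₀ = 1

/-- `(h₀, h₁)` is a pair of functions, continuous on the supports of `μ₀` and `μ₁`, solving the
Schrödinger system for `c_A` linearized at the potentials `(φ₀, φ₁)` in the direction `C`.
Only the values of `h₀` and `h₁` on the supports matter. -/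
structure IsLinearizedSolution {d₀ d₁ : ℕ}
    (μ₀ : Measure (EuclideanSpace ℝ (Fin d₀))) (μ₁ : Measure (EuclideanSpace ℝ (Fin d₁)))
    (ε : ℝ) (A C : Matrix (Fin d₀) (Fin d₁) ℝ)
    (φ₀ : EuclideanSpace ℝ (Fin d₀) → ℝ) (φ₁ : EuclideanSpace ℝ (Fin d₁) → ℝ)
    (h₀ : EuclideanSpace ℝ (Fin d₀) → ℝ) (h₁ : EuclideanSpace ℝ (Fin d₁) → ℝ) : Prop where
  continuousOn_fst : ContinuousOn h₀ μ₀.support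
  continuousOn_snd : ContinuousOn h₁ μ₁.support
  system_fst : ∀ x ∈ μ₀.support,
    ∫ y, (h₀ x + h₁ y - 32 * bilin C x y) *
      Real.exp ((φ₀ x + φ₁ y - costA A x y) / ε) ∂μ₁ = 0
  system_snd : ∀ y ∈ μ₁.support,
    ∫ x, (h₀ x + h₁ y - 32 * bilin C x y) *
      Real.exp ((φ₀ x + φ₁ y - costA A x y) / ε) ∂μ₀ = 0

/-- The objective `Φ(A) = 32 ‖A‖_F² + OT_{A,ε}(μ₀, μ₁)`; the norm is the Frobenius norm. -/
def Phi {d₀ d₁ : ℕ}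
    (μ₀ : Measure (EuclideanSpace ℝ (Fin d₀))) (μ₁ : Measure (EuclideanSpace ℝ (Fin d₁)))
    (ε : ℝ) (A : Matrix (Fin d₀) (Fin d₁) ℝ) : ℝ :=
  32 * ‖A‖ ^ 2 + (eotCost μ₀ μ₁ (costA A) ε).toReal

end

/-!
Write the potentials as `ε u` and `ε v`. Solving one of the two Schrödinger equations for `u` in
terms of `v` is a soft transform, and composing the two transforms gives a map which contracts
the oscillation seminorm strictly: on compact supports the tilted measures which occur in its
derivative dominate a fixed fraction of each other (Doeblin). So potentials exist and are unique up
to a constant. The same estimate makes the linearized system uniquely solvable modulo constants, so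
by the implicit function theorem the normalized potentials depend smoothly on the exponent
`-c / ε`, a continuous function on the product of the supports.

Tilting `μ₀ ⊗ μ₁` by the exponent and the potentials gives the Gibbs coupling, and the entropic
objective of a coupling exceeds the dual value exactly by `ε` times its divergence from the Gibbs
coupling. This identifies the value and the unique minimizer. Differentiating the marginal
constraints shows that the derivative of the value in the cost is integration against the
minimizer, and differentiating the Gibbs density once more gives the Hessian. Finally the value is
`1`-Lipschitz in the cost and the cost is affine in `A`, so `32 ‖A‖²` dominates at infinity.
-/

namespace EntropicTransport

noncomputable section

section ContinuousFunctions

variable {X Y Z W : Type*} [TopologicalSpace X] [TopologicalSpace Y] [TopologicalSpace Z]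
  [TopologicalSpace W]

theorem exp_apply [CompactSpace Z] (f : C(Z, ℝ)) (z : Z) :
    NormedSpace.exp f z = Real.exp (f z) := by
  have h := NormedSpace.map_exp (ContinuousMap.evalAlgHom ℝ ℝ z) (continuous_eval_const z) f
  rwa [← Real.exp_eq_exp_ℝ] at h

/-- Precomposition with `g`, as a continuous linear map between spaces of continuous functions. -/
def precomp (g : C(Z, W)) : C(W, ℝ) →L[ℝ] C(Z, ℝ) where
  toFun f := f.comp g
  map_add' _ _ := rfl
  map_smul' _ _ := rfl
  cont := ContinuousMap.continuous_precomp g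

@[simp]
theorem precomp_apply (g : C(Z, W)) (f : C(W, ℝ)) (z : Z) : precomp g f z = f (g z) := rfl

/-- The direct sum `(u, v) ↦ u ⊕ v`, where `(u ⊕ v)(x, y) = u(x) + v(y)`. -/
def directSum : C(X, ℝ) × C(Y, ℝ) →L[ℝ] C(X × Y, ℝ) :=
  (precomp ContinuousMap.fst).coprod (precomp ContinuousMap.snd)

theorem directSum_eq (w : C(X, ℝ) × C(Y, ℝ)) :
    directSum w = precomp ContinuousMap.fst w.1 + precomp ContinuousMap.snd w.2 := rfl

@[simp]
theorem directSum_apply (w : C(X, ℝ) × C(Y, ℝ)) (z : X × Y) :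
    directSum w z = w.1 z.1 + w.2 z.2 := rfl

section Integral

variable [CompactSpace Z] [MeasurableSpace Z] [OpensMeasurableSpace Z]

theorem integrable_continuousMap (ν : Measure Z) [IsFiniteMeasure ν] (f : C(Z, ℝ)) :
    Integrable f ν :=
  (BoundedContinuousFunction.mkOfCompact f).integrable ν

/-- Integration against a finite measure, as a continuous linear functional on `C(Z)`. -/
def integralL (ν : Measure Z) [IsFiniteMeasure ν] : C(Z, ℝ) →L[ℝ] ℝ :=
  LinearMap.mkContinuous
    { toFun := fun f => ∫ z, f z ∂ν
      map_add' := fun f g =>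
        integral_add (integrable_continuousMap ν f) (integrable_continuousMap ν g)
      map_smul' := fun c f => integral_const_mul c _ } (ν.real Set.univ) fun f => by
    rw [mul_comm]
    exact norm_integral_le_of_norm_le_const (ae_of_all _ f.norm_coe_le_norm)

theorem integralL_apply (ν : Measure Z) [IsFiniteMeasure ν] (f : C(Z, ℝ)) :
    integralL ν f = ∫ z, f z ∂ν := rfl

@[simp]
theorem integralL_one (ν : Measure Z) [IsProbabilityMeasure ν] : integralL ν 1 = 1 := by
  simp [integralL_apply]

theorem integrable_exp_continuousMap (ν : Measure Z) [IsFiniteMeasure ν] (a : C(Z, ℝ)) :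
    Integrable (fun z => Real.exp (a z)) ν := by
  have h := integrable_continuousMap ν (NormedSpace.exp a)
  rwa [funext (exp_apply a)] at h

end Integral

section Marginals

variable [CompactSpace X] [CompactSpace Y] [MeasurableSpace Y] [OpensMeasurableSpace Y]

/-- Integration over the second variable, as a continuous linear map `C(X × Y) → C(X)`. -/
def partialIntegral (X : Type*) [TopologicalSpace X] [CompactSpace X] (ν : Measure Y)
    [IsFiniteMeasure ν] : C(X × Y, ℝ) →L[ℝ] C(X, ℝ) :=
  LinearMap.mkContinuous
    { toFun := fun f => (integralL ν : C(C(Y, ℝ), ℝ)).comp f.curry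
      map_add' := fun f g => by
        ext x
        exact map_add (integralL ν) (f.curry x) (g.curry x)
      map_smul' := fun c f => by
        ext x
        exact map_smul (integralL ν) c (f.curry x) } (ν.real Set.univ) fun f => by
    refine (ContinuousMap.norm_le _ (by positivity)).2 fun x => ?_
    rw [mul_comm]
    exact norm_integral_le_of_norm_le_const (ae_of_all _ fun y => f.norm_coe_le_norm (x, y))

@[simp]
theorem partialIntegral_apply (ν : Measure Y) [IsFiniteMeasure ν] (f : C(X × Y, ℝ)) (x : X) :
    partialIntegral X ν f x = ∫ y, f (x, y) ∂ν := rfl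

variable [MeasurableSpace X] [OpensMeasurableSpace X]

/-- The densities of the two marginals of the measure with density `f` with respect to
`ν₀ ⊗ ν₁`. -/
def marginals (ν₀ : Measure X) (ν₁ : Measure Y) [IsFiniteMeasure ν₀] [IsFiniteMeasure ν₁] :
    C(X × Y, ℝ) →L[ℝ] C(X, ℝ) × C(Y, ℝ) :=
  (partialIntegral X ν₁).prod (partialIntegral Y ν₀ ∘L precomp ContinuousMap.prodSwap)

variable (ν₀ : Measure X) (ν₁ : Measure Y) [IsFiniteMeasure ν₀] [IsFiniteMeasure ν₁]
  (f : C(X × Y, ℝ))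

theorem marginals_fst : (marginals ν₀ ν₁ f).1 = partialIntegral X ν₁ f := rfl

theorem marginals_snd :
    (marginals ν₀ ν₁ f).2 = partialIntegral Y ν₀ (precomp ContinuousMap.prodSwap f) := rfl

theorem marginals_fst_apply (x : X) : (marginals ν₀ ν₁ f).1 x = ∫ y, f (x, y) ∂ν₁ := rfl

theorem marginals_snd_apply (y : Y) : (marginals ν₀ ν₁ f).2 y = ∫ x, f (x, y) ∂ν₀ := rfl

variable [SecondCountableTopologyEither X Y]

theorem integralL_marginals_fst :
    integralL ν₀ (marginals ν₀ ν₁ f).1 = integralL (ν₀.prod ν₁) f :=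
  (integral_prod _ (integrable_continuousMap (ν₀.prod ν₁) f)).symm

theorem integralL_marginals_snd :
    integralL ν₁ (marginals ν₀ ν₁ f).2 = integralL (ν₀.prod ν₁) f :=
  (integral_prod_symm _ (integrable_continuousMap (ν₀.prod ν₁) f)).symm

end Marginals

end ContinuousFunctions

section Oscillation

variable {Z : Type*}

/-- The oscillation `sup h - inf h` is at most `s`, stated pointwise to avoid the junk value of an
infinite supremum. -/
def OscLE (h : Z → ℝ) (s : ℝ) : Prop :=
  ∀ z z', h z - h z' ≤ s

theorem oscLE_two_mul_norm [TopologicalSpace Z] [CompactSpace Z] (h : C(Z, ℝ)) :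
    OscLE h (2 * ‖h‖) := fun z z' => by
  have hz := abs_le.1 (h.norm_coe_le_norm z)
  have hz' := abs_le.1 (h.norm_coe_le_norm z')
  linarith [hz.2, hz'.1]

theorem OscLE.of_sub_eq {h g : Z → ℝ} {s a : ℝ} (hs : OscLE h s) (hg : ∀ z, g z = h z - a) :
    OscLE g s := fun z z' => by
  rw [hg, hg, sub_sub_sub_cancel_right]
  exact hs z z'

variable [MeasurableSpace Z]

theorem OscLE.abs_sub_integral_le {ν : Measure Z} [IsProbabilityMeasure ν] {h : Z → ℝ} {s : ℝ}
    (hs : OscLE h s) (hi : Integrable h ν) (z : Z) : |h z - ∫ y, h y ∂ν| ≤ s := by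
  have hmean : ∫ y, (h z - h y) ∂ν = h z - ∫ y, h y ∂ν := by
    rw [integral_sub (integrable_const _) hi]
    simp
  rw [← hmean]
  simpa using norm_integral_le_of_norm_le_const (μ := ν)
    (f := fun y => h z - h y) (ae_of_all _ fun y => abs_le.2 ⟨by linarith [hs y z], hs z y⟩)

/-- **Doeblin's estimate**: the part `δ • Q` of `P` contributes nothing to the difference. -/
theorem OscLE.integral_sub_integral_le {P Q : Measure Z} [IsProbabilityMeasure P]
    [IsProbabilityMeasure Q] {h : Z → ℝ} {δ s : ℝ} (hs : OscLE h s) (hP : Integrable h P)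
    (hQ : Integrable h Q) (hδ : 0 ≤ δ) (hQP : ENNReal.ofReal δ • Q ≤ P) :
    ∫ z, h z ∂P - ∫ z, h z ∂Q ≤ (1 - δ) * s := by
  have : Nonempty Z := nonempty_of_isProbabilityMeasure P
  have hbdd : BddAbove (Set.range h) := by
    let z₀ := Classical.arbitrary Z
    exact ⟨h z₀ + s, Set.forall_mem_range.2 fun z => by linarith [hs z z₀]⟩
  set M := ⨆ z, h z
  have hgap : ∀ ρ : Measure Z, [IsProbabilityMeasure ρ] → Integrable h ρ →
      ∫ z, (M - h z) ∂ρ = M - ∫ z, h z ∂ρ := fun ρ _ hρ => by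
    rw [integral_sub (integrable_const _) hρ]
    simp
  have hδ1 : δ ≤ 1 := by simpa using hQP Set.univ
  have hdom : δ * (M - ∫ z, h z ∂Q) ≤ M - ∫ z, h z ∂P := by
    have hmono := integral_mono_measure hQP
      (ae_of_all _ fun z => sub_nonneg.2 (le_ciSup hbdd z)) ((integrable_const M).sub hP)
    rwa [integral_smul_measure, ENNReal.toReal_ofReal hδ, hgap Q hQ, hgap P hP] at hmono
  have hosc : M - ∫ z, h z ∂Q ≤ s := by
    rw [← hgap Q hQ]
    refine (integral_mono ((integrable_const M).sub hQ) (integrable_const s) fun z => ?_).trans_eq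
      (by simp)
    exact sub_le_iff_le_add.2 (ciSup_le fun z' => sub_le_iff_le_add.1 (hs z' z))
  nlinarith

theorem smul_tilted_le_tilted {ν : Measure Z} {a b : Z → ℝ} {r : ℝ}
    (ha : Integrable (fun z => Real.exp (a z)) ν) (hb : Integrable (fun z => Real.exp (b z)) ν)
    (hab : ∀ z, |a z - b z| ≤ r) :
    ENNReal.ofReal (Real.exp (-(2 * r))) • ν.tilted b ≤ ν.tilted a := by
  rcases eq_or_ne ν 0 with rfl | hν
  · simp
  have : NeZero ν := ⟨hν⟩
  have hmass : ∫ z, Real.exp (a z) ∂ν ≤ Real.exp r * ∫ z, Real.exp (b z) ∂ν := by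
    rw [← integral_const_mul]
    refine integral_mono ha (hb.const_mul _) fun z => ?_
    simp only [← Real.exp_add]
    exact Real.exp_le_exp.2 (by linarith [(abs_le.1 (hab z)).2])
  rw [Measure.tilted, Measure.tilted, ← withDensity_smul' _ _ ENNReal.ofReal_ne_top]
  refine withDensity_mono (ae_of_all _ fun z => ?_)
  simp only [Pi.smul_apply, smul_eq_mul]
  rw [← ENNReal.ofReal_mul (Real.exp_pos _).le]
  refine ENNReal.ofReal_le_ofReal ?_
  have hA := integral_exp_pos ha
  have hB := integral_exp_pos hb
  rw [← mul_div_assoc, div_le_div_iff₀ hB hA]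
  calc Real.exp (-(2 * r)) * Real.exp (b z) * ∫ z, Real.exp (a z) ∂ν
      ≤ Real.exp (-(2 * r)) * Real.exp (b z) * (Real.exp r * ∫ z, Real.exp (b z) ∂ν) := by gcongr
    _ = Real.exp (b z - r) * ∫ z, Real.exp (b z) ∂ν := by
      rw [← mul_assoc, ← Real.exp_add, ← Real.exp_add]
      ring_nf
    _ ≤ Real.exp (a z) * ∫ z, Real.exp (b z) ∂ν := by
      gcongr
      linarith [(abs_le.1 (hab z)).1]

theorem OscLE.integral_tilted_sub_le [TopologicalSpace Z] [CompactSpace Z]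
    [OpensMeasurableSpace Z] {ν : Measure Z} [IsProbabilityMeasure ν] {a b h : C(Z, ℝ)} {r s : ℝ}
    (hs : OscLE h s) (hab : ∀ z, |a z - b z| ≤ r) :
    ∫ z, h z ∂ν.tilted a - ∫ z, h z ∂ν.tilted b ≤ (1 - Real.exp (-(2 * r))) * s := by
  have ha := integrable_exp_continuousMap ν a
  have hb := integrable_exp_continuousMap ν b
  have := isProbabilityMeasure_tilted ha
  have := isProbabilityMeasure_tilted hb
  exact hs.integral_sub_integral_le (integrable_continuousMap _ h) (integrable_continuousMap _ h)
    (Real.exp_pos _).le (smul_tilted_le_tilted ha hb hab)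

end Oscillation

section OscLipschitz

variable {X Y Z : Type*} [TopologicalSpace X] [TopologicalSpace Y] [TopologicalSpace Z]

/-- `F` is Lipschitz with constant `K` for the oscillation seminorm. -/
def OscLipschitzWith (K : ℝ) (F : C(X, ℝ) → C(Y, ℝ)) : Prop :=
  ∀ v w s, OscLE (v - w : C(X, ℝ)) s → OscLE (F v - F w : C(Y, ℝ)) (K * s)

theorem OscLipschitzWith.comp {K L : ℝ} {G : C(Y, ℝ) → C(Z, ℝ)} {F : C(X, ℝ) → C(Y, ℝ)}
    (hG : OscLipschitzWith L G) (hF : OscLipschitzWith K F) :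
    OscLipschitzWith (L * K) (G ∘ F) := fun v w s hs => by
  rw [mul_assoc]
  exact hG _ _ _ (hF _ _ _ hs)

theorem OscLipschitzWith.iterate {K : ℝ} {F : C(X, ℝ) → C(X, ℝ)} (hF : OscLipschitzWith K F)
    (n : ℕ) : OscLipschitzWith (K ^ n) F^[n] := by
  induction n with
  | zero => simp [OscLipschitzWith]
  | succ n ih =>
    rw [Function.iterate_succ', pow_succ']
    exact hF.comp ih

variable [CompactSpace Z] [MeasurableSpace Z] [OpensMeasurableSpace Z]

theorem OscLipschitzWith.norm_sub_le {K : ℝ} (hK : 0 ≤ K) {F : C(Z, ℝ) → C(Z, ℝ)}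
    (hF : OscLipschitzWith K F) (ν : Measure Z) [IsProbabilityMeasure ν]
    {v w : C(Z, ℝ)} (hmean : integralL ν (F v - F w) = 0) : ‖F v - F w‖ ≤ 2 * K * ‖v - w‖ := by
  refine (ContinuousMap.norm_le _ (by positivity)).2 fun z => ?_
  have h := (hF v w _ (oscLE_two_mul_norm _)).abs_sub_integral_le (integrable_continuousMap ν _) z
  rw [← integralL_apply, hmean, sub_zero] at h
  rw [Real.norm_eq_abs]
  linarith

/-- Iterating makes `F` a contraction in norm, since the oscillation controls the norm of functions
of mean zero. -/
theorem OscLipschitzWith.existsUnique_fixedPoint {K : ℝ} (hK : 0 ≤ K) (hK1 : K < 1)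
    {F : C(Z, ℝ) → C(Z, ℝ)} (hF : OscLipschitzWith K F) (ν : Measure Z) [IsProbabilityMeasure ν]
    (hmean : ∀ v w, integralL ν (F v - F w) = 0) : ∃! v, F v = v := by
  obtain ⟨n, hn⟩ := exists_pow_lt_of_lt_one (show (0 : ℝ) < 2⁻¹ by norm_num) hK1
  have hlt : 2 * K ^ (n + 1) < 1 := by
    have hle : K ^ (n + 1) ≤ K ^ n := pow_le_pow_of_le_one hK hK1.le n.le_succ
    linarith
  have hpos : 0 ≤ 2 * K ^ (n + 1) := by positivity
  have hcontr : ContractingWith (NNReal.mk (2 * K ^ (n + 1)) hpos) F^[n + 1] := by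
    refine ⟨hlt, LipschitzWith.of_dist_le_mul fun v w => ?_⟩
    rw [dist_eq_norm, dist_eq_norm]
    refine (hF.iterate (n + 1)).norm_sub_le (by positivity) ν ?_
    rw [Function.iterate_succ_apply', Function.iterate_succ_apply']
    exact hmean _ _
  exact ⟨_, hcontr.isFixedPt_fixedPoint_iterate,
    fun w hw => hcontr.fixedPoint_unique (Function.IsFixedPt.iterate hw (n + 1))⟩

theorem OscLipschitzWith.existsUnique_centered_fixedPoint {K : ℝ} (hK : 0 ≤ K) (hK1 : K < 1)
    {F : C(Z, ℝ) → C(Z, ℝ)} (hF : OscLipschitzWith K F) (ν : Measure Z) [IsProbabilityMeasure ν]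
    (c : C(Z, ℝ)) : ∃! v, F v - integralL ν (F v) • 1 + c = v := by
  refine OscLipschitzWith.existsUnique_fixedPoint hK hK1 (fun v w s hs => ?_) ν fun v w => ?_
  · refine (hF v w s hs).of_sub_eq (a := integralL ν (F v) - integralL ν (F w)) fun z => ?_
    simp only [ContinuousMap.sub_apply, ContinuousMap.add_apply, ContinuousMap.smul_apply,
      ContinuousMap.one_apply, smul_eq_mul, mul_one]
    ring
  · simp

end OscLipschitz

section Sinkhorn

variable {X Y : Type*} [TopologicalSpace X] [CompactSpace X] [TopologicalSpace Y] [CompactSpace Y]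

theorem norm_precomp_prodSwap_le (k : C(X × Y, ℝ)) : ‖precomp ContinuousMap.prodSwap k‖ ≤ ‖k‖ :=
  (ContinuousMap.norm_le _ (norm_nonneg k)).2 fun z => k.norm_coe_le_norm z.swap

theorem abs_curry_sub_le {k : C(X × Y, ℝ)} {r : ℝ} (hk : ‖k‖ ≤ r) (x x' : X) (y : Y) :
    |k.curry x y - k.curry x' y| ≤ 2 * r := by
  have hx := abs_le.1 (k.norm_coe_le_norm (x, y))
  have hx' := abs_le.1 (k.norm_coe_le_norm (x', y))
  rw [ContinuousMap.curry_apply, ContinuousMap.curry_apply, abs_le]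
  constructor <;> linarith [hx.1, hx.2, hx'.1, hx'.2]

variable [MeasurableSpace Y] [OpensMeasurableSpace Y]

theorem hasDerivAt_log_integral_exp (ν : Measure Y) [IsProbabilityMeasure ν] (a h : C(Y, ℝ))
    (t : ℝ) :
    HasDerivAt (fun t : ℝ => Real.log (∫ y, Real.exp ((a + t • h) y) ∂ν))
      (∫ y, h y ∂ν.tilted (a + t • h : C(Y, ℝ))) t := by
  have hline : HasDerivAt (fun t : ℝ => a + t • h) h t := by
    simpa using ((hasDerivAt_id t).smul_const h).const_add a
  have hint : HasDerivAt (fun t : ℝ => ∫ y, Real.exp ((a + t • h) y) ∂ν)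
      (∫ y, Real.exp ((a + t • h) y) * h y ∂ν) t := by
    simpa [Function.comp_def, integralL_apply, exp_apply] using
      ((integralL ν).hasFDerivAt.comp _
        (hasStrictFDerivAt_exp (x := a + t • h)).hasFDerivAt).comp_hasDerivAt t hline
  convert hint.log (integral_exp_pos (integrable_exp_continuousMap ν (a + t • h))).ne' using 1
  simp only [integral_tilted, smul_eq_mul, div_mul_eq_mul_div, integral_div]

/-- The increments of log-sum-exp at nearby exponents differ by less than the oscillation of the
increment: the mean value theorem reduces this to Doeblin's estimate for tilted measures. -/
theorem log_integral_exp_sub_le {ν : Measure Y} [IsProbabilityMeasure ν] {a b h : C(Y, ℝ)}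
    {r s : ℝ} (hab : ∀ y, |a y - b y| ≤ r) (hs : OscLE h s) :
    (Real.log (∫ y, Real.exp ((a + h) y) ∂ν) - Real.log (∫ y, Real.exp ((b + h) y) ∂ν)) -
      (Real.log (∫ y, Real.exp (a y) ∂ν) - Real.log (∫ y, Real.exp (b y) ∂ν)) ≤
      (1 - Real.exp (-(2 * r))) * s := by
  have hderiv := fun t =>
    (hasDerivAt_log_integral_exp ν a h t).sub (hasDerivAt_log_integral_exp ν b h t)
  obtain ⟨t, -, ht⟩ := exists_hasDerivAt_eq_slope _ _ zero_lt_one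
    (fun t _ => (hderiv t).continuousAt.continuousWithinAt) (fun t _ => hderiv t)
  have hbound := hs.integral_tilted_sub_le (ν := ν) (a := a + t • h) (b := b + t • h)
    (fun y => by simpa using hab y)
  rw [ht] at hbound
  simpa using hbound

/-- The Sinkhorn half step: the `u` for which `exp (u(x) + v(y) + k(x, y))` has integral `1` with
respect to `y`. -/
def sinkhorn (ν : Measure Y) [IsProbabilityMeasure ν] (k : C(X × Y, ℝ)) (v : C(Y, ℝ)) :
    C(X, ℝ) where
  toFun x := -Real.log (∫ y, Real.exp ((v + k.curry x) y) ∂ν)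
  continuous_toFun := by
    have hcont := map_continuous
      (partialIntegral X ν (NormedSpace.exp (precomp ContinuousMap.snd v + k)))
    simp only [funext (partialIntegral_apply ν _), exp_apply] at hcont
    exact (hcont.log fun x =>
      (integral_exp_pos (integrable_exp_continuousMap ν (v + k.curry x))).ne').neg

theorem sinkhorn_apply (ν : Measure Y) [IsProbabilityMeasure ν] (k : C(X × Y, ℝ)) (v : C(Y, ℝ))
    (x : X) : sinkhorn ν k v x = -Real.log (∫ y, Real.exp ((v + k.curry x) y) ∂ν) := rfl

theorem oscLipschitzWith_sinkhorn (ν : Measure Y) [IsProbabilityMeasure ν] {k : C(X × Y, ℝ)}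
    {r : ℝ} (hk : ‖k‖ ≤ r) : OscLipschitzWith (1 - Real.exp (-(4 * r))) (sinkhorn ν k) :=
  fun v w s hs x x' => by
  have h := log_integral_exp_sub_le (ν := ν) (a := w + k.curry x') (b := w + k.curry x)
    (r := 2 * r) (fun y => by simpa using abs_curry_sub_le hk x' x y) hs
  rw [show w + k.curry x' + (v - w) = v + k.curry x' by abel,
    show w + k.curry x + (v - w) = v + k.curry x by abel, ← mul_assoc] at h
  norm_num1 at h
  simp only [ContinuousMap.sub_apply, sinkhorn_apply]
  linarith

/-- The integral operator with kernel `γ`. -/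
def kernelOperator (ν : Measure Y) [IsFiniteMeasure ν] (γ : C(X × Y, ℝ)) : C(Y, ℝ) →L[ℝ] C(X, ℝ) :=
  partialIntegral X ν ∘L ContinuousLinearMap.mul ℝ _ γ ∘L precomp ContinuousMap.snd

theorem kernelOperator_apply (ν : Measure Y) [IsFiniteMeasure ν] (γ : C(X × Y, ℝ)) (h : C(Y, ℝ))
    (x : X) : kernelOperator ν γ h x = ∫ y, γ (x, y) * h y ∂ν := rfl

theorem oscLipschitzWith_kernelOperator {ν : Measure Y} [IsProbabilityMeasure ν]
    {a : C(X × Y, ℝ)} {r : ℝ} (ha : ‖a‖ ≤ r)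
    (hone : partialIntegral X ν (NormedSpace.exp a) = 1) :
    OscLipschitzWith (1 - Real.exp (-(4 * r))) (kernelOperator ν (NormedSpace.exp a)) := by
  have htilted : ∀ (h : C(Y, ℝ)) x, kernelOperator ν (NormedSpace.exp a) h x =
      ∫ y, h y ∂ν.tilted (a.curry x) := fun h x => by
    have hx : ∫ y, Real.exp (a (x, y)) ∂ν = 1 := by
      simpa [exp_apply] using DFunLike.congr_fun hone x
    simp [kernelOperator_apply, integral_tilted, exp_apply, hx]
  intro v w s hs x x'
  rw [← map_sub (kernelOperator ν _), htilted, htilted]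
  have h := hs.integral_tilted_sub_le (ν := ν) (abs_curry_sub_le ha x x')
  rw [← mul_assoc] at h
  norm_num1 at h
  exact h

end Sinkhorn

theorem existsUnique_prod_of_existsUnique {α β : Type*} (S : β → α) {p : β → Prop}
    (h : ∃! v, p v) : ∃! w : α × β, w.1 = S w.2 ∧ p w.2 := by
  obtain ⟨v, hv, huniq⟩ := h
  refine ⟨(S v, v), ⟨rfl, hv⟩, fun w ⟨hw₁, hw₂⟩ => ?_⟩
  obtain rfl := huniq _ hw₂
  exact Prod.ext hw₁ rfl

section SchrodingerSystem

variable {X Y : Type*} [TopologicalSpace X] [TopologicalSpace Y]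

theorem directSum_shift (w : C(X, ℝ) × C(Y, ℝ)) (a : ℝ) :
    directSum (w.1 + a • 1, w.2 - a • 1) = directSum w := by
  ext z
  simp

variable [CompactSpace Y]

section Gauge

variable [MeasurableSpace Y] [OpensMeasurableSpace Y] (ν : Measure Y) [IsFiniteMeasure ν]

/-- The term `(u, v) ↦ (0, ∫ v)` which, added to an invariant of `(u + a, v - a)`, singles out the
pairs with `∫ v = 0`. -/
def gauge : C(X, ℝ) × C(Y, ℝ) →L[ℝ] C(X, ℝ) × C(Y, ℝ) :=
  ContinuousLinearMap.inr ℝ _ _ ∘L (integralL ν).smulRight 1 ∘L ContinuousLinearMap.snd ℝ _ _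

theorem gauge_apply (w : C(X, ℝ) × C(Y, ℝ)) : gauge ν w = (0, integralL ν w.2 • 1) := rfl

end Gauge

variable [CompactSpace X]

/-- The Gibbs density `exp (u ⊕ v + k)` with exponent `k` and potentials `(u, v)`. -/
def gibbs (k : C(X × Y, ℝ)) (w : C(X, ℝ) × C(Y, ℝ)) : C(X × Y, ℝ) :=
  NormedSpace.exp (directSum w + k)

theorem gibbs_apply (k : C(X × Y, ℝ)) (w : C(X, ℝ) × C(Y, ℝ)) (z : X × Y) :
    gibbs k w z = Real.exp (w.1 z.1 + w.2 z.2 + k z) := exp_apply _ z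

theorem gibbs_add_const_snd (k : C(X × Y, ℝ)) (w : C(X, ℝ) × C(Y, ℝ)) (b : ℝ) :
    gibbs k (w.1, w.2 + b • 1) = Real.exp b • gibbs k w := by
  ext z
  simp only [gibbs_apply, ContinuousMap.add_apply, ContinuousMap.smul_apply,
    ContinuousMap.one_apply, smul_eq_mul, ← Real.exp_add]
  ring_nf

theorem precomp_prodSwap_gibbs (k : C(X × Y, ℝ)) (w : C(X, ℝ) × C(Y, ℝ)) :
    precomp ContinuousMap.prodSwap (gibbs k w) =
      gibbs (precomp ContinuousMap.prodSwap k) w.swap := by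
  ext z
  simp [gibbs_apply, add_comm]

theorem contDiff_gibbs {n : WithTop ℕ∞} :
    ContDiff ℝ n fun q : C(X × Y, ℝ) × (C(X, ℝ) × C(Y, ℝ)) => gibbs q.1 q.2 := by
  have hexp : ContDiff ℝ n (NormedSpace.exp : C(X × Y, ℝ) → C(X × Y, ℝ)) :=
    contDiff_iff_contDiffAt.2 fun f => (NormedSpace.exp_analytic (𝕂 := ℝ) f).contDiffAt
  exact hexp.comp (directSum ∘L ContinuousLinearMap.snd ℝ C(X × Y, ℝ) (C(X, ℝ) × C(Y, ℝ)) +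
    ContinuousLinearMap.fst ℝ _ _).contDiff

theorem hasFDerivAt_gibbs (k : C(X × Y, ℝ)) (w : C(X, ℝ) × C(Y, ℝ)) :
    HasFDerivAt (fun q : C(X × Y, ℝ) × (C(X, ℝ) × C(Y, ℝ)) => gibbs q.1 q.2)
      (ContinuousLinearMap.mul ℝ _ (gibbs k w) ∘L
        (directSum ∘L ContinuousLinearMap.snd ℝ _ _ + ContinuousLinearMap.fst ℝ _ _)) (k, w) :=
  hasStrictFDerivAt_exp.hasFDerivAt.comp (k, w)
    (directSum ∘L ContinuousLinearMap.snd ℝ C(X × Y, ℝ) (C(X, ℝ) × C(Y, ℝ)) +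
      ContinuousLinearMap.fst ℝ _ _).hasFDerivAt

variable [MeasurableSpace Y] [OpensMeasurableSpace Y]

theorem partialIntegral_mul_precomp_fst (ν : Measure Y) [IsFiniteMeasure ν] (f : C(X × Y, ℝ))
    (g : C(X, ℝ)) :
    partialIntegral X ν (f * precomp ContinuousMap.fst g) = partialIntegral X ν f * g := by
  ext x
  exact integral_mul_const (g x) _

theorem partialIntegral_gibbs_eq_one_iff
    {ν : Measure Y} [IsProbabilityMeasure ν] {k : C(X × Y, ℝ)} {w : C(X, ℝ) × C(Y, ℝ)} :
    partialIntegral X ν (gibbs k w) = 1 ↔ w.1 = sinkhorn ν k w.2 := by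
  rw [ContinuousMap.ext_iff, ContinuousMap.ext_iff]
  refine forall_congr' fun x => ?_
  have hpos := integral_exp_pos (integrable_exp_continuousMap ν (w.2 + k.curry x))
  have hfactor : ∫ y, gibbs k w (x, y) ∂ν =
      Real.exp (w.1 x) * ∫ y, Real.exp ((w.2 + k.curry x) y) ∂ν := by
    simp [gibbs_apply, add_assoc, Real.exp_add (w.1 x), integral_const_mul]
  rw [partialIntegral_apply, hfactor, ContinuousMap.one_apply, sinkhorn_apply,
    mul_eq_one_iff_eq_inv₀ hpos.ne', ← Real.exp_injective.eq_iff (a := w.1 x),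
    Real.exp_neg, Real.exp_log hpos]

variable [MeasurableSpace X] [OpensMeasurableSpace X]

section Schrodinger

variable {ν₀ : Measure X} {ν₁ : Measure Y} [IsProbabilityMeasure ν₀] [IsProbabilityMeasure ν₁]
  {k : C(X × Y, ℝ)} {w : C(X, ℝ) × C(Y, ℝ)}

theorem marginals_snd_gibbs_eq_one_iff :
    (marginals ν₀ ν₁ (gibbs k w)).2 = 1 ↔
      w.2 = sinkhorn ν₀ (precomp ContinuousMap.prodSwap k) w.1 := by
  rw [marginals_snd, precomp_prodSwap_gibbs, partialIntegral_gibbs_eq_one_iff, Prod.fst_swap,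
    Prod.snd_swap]

theorem marginals_gibbs_eq_one_iff :
    marginals ν₀ ν₁ (gibbs k w) = 1 ↔
      w.1 = sinkhorn ν₁ k w.2 ∧ w.2 = sinkhorn ν₀ (precomp ContinuousMap.prodSwap k) w.1 := by
  rw [Prod.ext_iff, ← marginals_snd_gibbs_eq_one_iff (ν₁ := ν₁),
    ← partialIntegral_gibbs_eq_one_iff]
  rfl

variable (ν₀ ν₁ k) in
/-- A full Sinkhorn iteration, on the second potential. -/
def sinkhornStep : C(Y, ℝ) → C(Y, ℝ) :=
  sinkhorn ν₀ (precomp ContinuousMap.prodSwap k) ∘ sinkhorn ν₁ k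

variable [SecondCountableTopologyEither X Y]

/-- A solution of the system up to a constant is a solution: the two marginals of the Gibbs density
have the same total mass. -/
theorem marginals_gibbs_eq_one_and_integral_iff :
    marginals ν₀ ν₁ (gibbs k w) = 1 ∧ integralL ν₁ w.2 = 0 ↔
      w.1 = sinkhorn ν₁ k w.2 ∧
        sinkhornStep ν₀ ν₁ k w.2 - integralL ν₁ (sinkhornStep ν₀ ν₁ k w.2) • 1 + 0 = w.2 := by
  constructor
  · rintro ⟨hw, hmean⟩
    obtain ⟨h₁, h₂⟩ := marginals_gibbs_eq_one_iff.1 hw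
    have hstep : sinkhornStep ν₀ ν₁ k w.2 = w.2 := by
      rw [sinkhornStep, Function.comp_apply, ← h₁, ← h₂]
    refine ⟨h₁, ?_⟩
    rw [hstep, hmean]
    simp
  · rintro ⟨h₁, h₂⟩
    set b := integralL ν₁ (sinkhornStep ν₀ ν₁ k w.2)
    have hfst : (marginals ν₀ ν₁ (gibbs k w)).1 = 1 := partialIntegral_gibbs_eq_one_iff.2 h₁
    have hsnd : Real.exp b • (marginals ν₀ ν₁ (gibbs k w)).2 = 1 := by
      rw [← Prod.smul_snd, ← map_smul, ← gibbs_add_const_snd, marginals_snd_gibbs_eq_one_iff, h₁]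
      rw [add_zero, sub_eq_iff_eq_add] at h₂
      exact h₂.symm
    have hmass : integralL ν₁ (marginals ν₀ ν₁ (gibbs k w)).2 = 1 := by
      rw [integralL_marginals_snd, ← integralL_marginals_fst, hfst, integralL_one]
    have hb : Real.exp b = 1 := by
      simpa [hmass] using congrArg (integralL ν₁) hsnd
    refine ⟨Prod.ext hfst (by simpa [hb] using hsnd), ?_⟩
    rw [← h₂]
    simp [b]

variable (ν₀ ν₁ k) in
theorem existsUnique_potentials :
    ∃! w : C(X, ℝ) × C(Y, ℝ), marginals ν₀ ν₁ (gibbs k w) = 1 ∧ integralL ν₁ w.2 = 0 := by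
  simp only [marginals_gibbs_eq_one_and_integral_iff]
  have hexp : Real.exp (-(4 * ‖k‖)) ≤ 1 := Real.exp_le_one_iff.2 (by linarith [norm_nonneg k])
  refine existsUnique_prod_of_existsUnique _
    (OscLipschitzWith.existsUnique_centered_fixedPoint (mul_self_nonneg _) ?_
      ((oscLipschitzWith_sinkhorn ν₀ (norm_precomp_prodSwap_le k)).comp
        (oscLipschitzWith_sinkhorn ν₁ le_rfl)) ν₁ 0)
  nlinarith [Real.exp_pos (-(4 * ‖k‖))]

variable (ν₀ ν₁) in
/-- The solution of the Schrödinger system with exponent `k` whose second component has mean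
zero. -/
def potentials (k : C(X × Y, ℝ)) : C(X, ℝ) × C(Y, ℝ) :=
  (existsUnique_potentials ν₀ ν₁ k).choose

variable (ν₀ ν₁) in
/-- The density, with respect to `ν₀ ⊗ ν₁`, of the optimal coupling for the exponent `k`. -/
def optimalDensity (k : C(X × Y, ℝ)) : C(X × Y, ℝ) :=
  gibbs k (potentials ν₀ ν₁ k)

variable (ν₀ ν₁) in
theorem marginals_optimalDensity (k : C(X × Y, ℝ)) :
    marginals ν₀ ν₁ (optimalDensity ν₀ ν₁ k) = 1 :=
  (existsUnique_potentials ν₀ ν₁ k).choose_spec.1.1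

variable (ν₀ ν₁) in
theorem integralL_potentials_snd (k : C(X × Y, ℝ)) : integralL ν₁ (potentials ν₀ ν₁ k).2 = 0 :=
  (existsUnique_potentials ν₀ ν₁ k).choose_spec.1.2

theorem eq_potentials (hw : marginals ν₀ ν₁ (gibbs k w) = 1) (hmean : integralL ν₁ w.2 = 0) :
    w = potentials ν₀ ν₁ k :=
  (existsUnique_potentials ν₀ ν₁ k).choose_spec.2 w ⟨hw, hmean⟩

theorem directSum_eq_directSum_potentials (hw : marginals ν₀ ν₁ (gibbs k w) = 1) :
    directSum w = directSum (potentials ν₀ ν₁ k) := by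
  rw [← directSum_shift w (integralL ν₁ w.2)]
  congr 1
  refine eq_potentials ?_ (by simp)
  rwa [gibbs, directSum_shift]

theorem gibbs_eq_optimalDensity (hw : marginals ν₀ ν₁ (gibbs k w) = 1) :
    gibbs k w = optimalDensity ν₀ ν₁ k := by
  rw [optimalDensity, gibbs, gibbs, directSum_eq_directSum_potentials hw]

end Schrodinger

section Linearization

variable {ν₀ : Measure X} {ν₁ : Measure Y} [IsProbabilityMeasure ν₀] [IsProbabilityMeasure ν₁]
  {γ : C(X × Y, ℝ)}

theorem marginals_mul_precomp_fst (hγ : marginals ν₀ ν₁ γ = 1) (g : C(X, ℝ)) :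
    marginals ν₀ ν₁ (γ * precomp ContinuousMap.fst g) =
      (g, kernelOperator ν₀ (precomp ContinuousMap.prodSwap γ) g) := by
  refine Prod.ext ?_ rfl
  rw [marginals_fst, partialIntegral_mul_precomp_fst, ← marginals_fst ν₀, hγ, Prod.fst_one,
    one_mul]

theorem marginals_mul_precomp_snd (hγ : marginals ν₀ ν₁ γ = 1) (h : C(Y, ℝ)) :
    marginals ν₀ ν₁ (γ * precomp ContinuousMap.snd h) = (kernelOperator ν₁ γ h, h) := by
  refine Prod.ext rfl ?_
  have hswap : precomp ContinuousMap.prodSwap (γ * precomp ContinuousMap.snd h) =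
      precomp ContinuousMap.prodSwap γ * precomp ContinuousMap.fst h := rfl
  rw [marginals_snd, hswap, partialIntegral_mul_precomp_fst, ← marginals_snd ν₀ ν₁, hγ,
    Prod.snd_one, one_mul]

theorem marginals_mul_directSum (hγ : marginals ν₀ ν₁ γ = 1) (h : C(X, ℝ) × C(Y, ℝ)) :
    marginals ν₀ ν₁ (γ * directSum h) =
      (h.1 + kernelOperator ν₁ γ h.2,
        kernelOperator ν₀ (precomp ContinuousMap.prodSwap γ) h.1 + h.2) := by
  rw [directSum_eq, mul_add, map_add, marginals_mul_precomp_fst hγ, marginals_mul_precomp_snd hγ]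
  rfl

variable [SecondCountableTopologyEither X Y]

theorem integralL_kernelOperator (hγ : marginals ν₀ ν₁ γ = 1) (h : C(Y, ℝ)) :
    integralL ν₀ (kernelOperator ν₁ γ h) = integralL ν₁ h := by
  have hfst := integralL_marginals_fst ν₀ ν₁ (γ * precomp ContinuousMap.snd h)
  have hsnd := integralL_marginals_snd ν₀ ν₁ (γ * precomp ContinuousMap.snd h)
  rw [marginals_mul_precomp_snd hγ] at hfst hsnd
  rw [hfst, hsnd]

theorem integralL_kernelOperator_prodSwap (hγ : marginals ν₀ ν₁ γ = 1) (g : C(X, ℝ)) :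
    integralL ν₁ (kernelOperator ν₀ (precomp ContinuousMap.prodSwap γ) g) = integralL ν₀ g := by
  have hfst := integralL_marginals_fst ν₀ ν₁ (γ * precomp ContinuousMap.fst g)
  have hsnd := integralL_marginals_snd ν₀ ν₁ (γ * precomp ContinuousMap.fst g)
  rw [marginals_mul_precomp_fst hγ] at hfst hsnd
  rw [hfst, hsnd]

theorem integralL_mul_directSum (hγ : marginals ν₀ ν₁ γ = 1) (h : C(X, ℝ) × C(Y, ℝ)) :
    integralL (ν₀.prod ν₁) (γ * directSum h) = integralL ν₀ h.1 + integralL ν₁ h.2 := by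
  rw [← integralL_marginals_fst, marginals_mul_directSum hγ, map_add, integralL_kernelOperator hγ]

theorem marginals_add_gauge_eq_iff {f : C(X × Y, ℝ)} {w p : C(X, ℝ) × C(Y, ℝ)}
    (hp : integralL ν₀ p.1 = integralL ν₁ p.2) :
    marginals ν₀ ν₁ f + gauge ν₁ w = p ↔ marginals ν₀ ν₁ f = p ∧ integralL ν₁ w.2 = 0 := by
  constructor
  · intro h
    have hmean : integralL ν₁ w.2 = 0 := by
      have hfst := congrArg (fun q => integralL ν₀ q.1) h
      have hsnd := congrArg (fun q => integralL ν₁ q.2) h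
      simp only [gauge_apply, Prod.fst_add, Prod.snd_add, add_zero, map_add, map_smul,
        integralL_marginals_fst, integralL_marginals_snd, integralL_one, smul_eq_mul,
        mul_one] at hfst hsnd
      linarith
    refine ⟨?_, hmean⟩
    rwa [gauge_apply, hmean, zero_smul, Prod.mk_zero_zero, add_zero] at h
  · rintro ⟨rfl, hmean⟩
    rw [gauge_apply, hmean, zero_smul, Prod.mk_zero_zero, add_zero]

theorem marginals_mul_directSum_add_gauge_eq_iff (hγ : marginals ν₀ ν₁ γ = 1)
    {g h : C(X, ℝ) × C(Y, ℝ)} :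
    let P := kernelOperator ν₁ γ
    let Q := kernelOperator ν₀ (precomp ContinuousMap.prodSwap γ)
    marginals ν₀ ν₁ (γ * directSum h) + gauge ν₁ h = g ↔
      h.1 = g.1 - P h.2 ∧ Q (P h.2) - integralL ν₁ (Q (P h.2)) • 1 + (g.2 - Q g.1) = h.2 := by
  intro P Q
  rw [marginals_mul_directSum hγ, gauge_apply, integralL_kernelOperator_prodSwap hγ,
    integralL_kernelOperator hγ, Prod.ext_iff]
  simp only [Prod.fst_add, Prod.snd_add, add_zero, ← eq_sub_iff_add_eq]
  refine and_congr_right fun hfst => ?_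
  rw [hfst, map_sub]
  constructor <;> intro hsnd <;> linear_combination -hsnd

theorem existsUnique_marginals_mul_directSum_add_gauge {a : C(X × Y, ℝ)}
    (ha : marginals ν₀ ν₁ (NormedSpace.exp a) = 1) (g : C(X, ℝ) × C(Y, ℝ)) :
    ∃! h, marginals ν₀ ν₁ (NormedSpace.exp a * directSum h) + gauge ν₁ h = g := by
  simp only [marginals_mul_directSum_add_gauge_eq_iff ha]
  have hexp : Real.exp (-(4 * ‖a‖)) ≤ 1 := Real.exp_le_one_iff.2 (by linarith [norm_nonneg a])
  have hswap : precomp ContinuousMap.prodSwap (NormedSpace.exp a) =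
      NormedSpace.exp (precomp ContinuousMap.prodSwap a) := by
    ext z
    simp [exp_apply]
  have hP := oscLipschitzWith_kernelOperator (ν := ν₁) le_rfl (congrArg Prod.fst ha)
  have hQ := oscLipschitzWith_kernelOperator (ν := ν₀) (norm_precomp_prodSwap_le a) (by
    rw [← hswap]
    exact congrArg Prod.snd ha)
  rw [← hswap] at hQ
  refine existsUnique_prod_of_existsUnique (fun v => g.1 - kernelOperator ν₁ _ v)
    (OscLipschitzWith.existsUnique_centered_fixedPoint (mul_self_nonneg _) ?_ (hQ.comp hP) ν₁ _)
  nlinarith [Real.exp_pos (-(4 * ‖a‖))]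

variable {k : C(X × Y, ℝ)} {w : C(X, ℝ) × C(Y, ℝ)}

theorem exists_marginals_gibbs_mul_eq_zero (hw : marginals ν₀ ν₁ (gibbs k w) = 1)
    (κ : C(X × Y, ℝ)) : ∃ h, marginals ν₀ ν₁ (gibbs k w * (directSum h + κ)) = 0 := by
  obtain ⟨h, hh, -⟩ := existsUnique_marginals_mul_directSum_add_gauge hw
    (-marginals ν₀ ν₁ (gibbs k w * κ))
  have hmass : integralL ν₀ (-marginals ν₀ ν₁ (gibbs k w * κ)).1 =
      integralL ν₁ (-marginals ν₀ ν₁ (gibbs k w * κ)).2 := by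
    rw [Prod.fst_neg, Prod.snd_neg, map_neg, map_neg, integralL_marginals_fst,
      integralL_marginals_snd]
  refine ⟨h, ?_⟩
  rw [mul_add, map_add, add_eq_zero_iff_eq_neg]
  exact ((marginals_add_gauge_eq_iff hmass).1 hh).1

theorem exists_eq_const_of_marginals_gibbs_mul_eq_zero (hw : marginals ν₀ ν₁ (gibbs k w) = 1)
    {h : C(X, ℝ) × C(Y, ℝ)} (hh : marginals ν₀ ν₁ (gibbs k w * directSum h) = 0) :
    ∃ a : ℝ, h = (a • 1, -a • 1) := by
  set b := integralL ν₁ h.2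
  have hshift : marginals ν₀ ν₁ (gibbs k w * directSum (h.1 + b • 1, h.2 - b • 1)) +
      gauge ν₁ (h.1 + b • 1, h.2 - b • 1) = 0 := by
    rw [marginals_add_gauge_eq_iff (by simp), directSum_shift]
    exact ⟨hh, by simp [b]⟩
  have hzero : (h.1 + b • 1, h.2 - b • 1) = 0 :=
    (existsUnique_marginals_mul_directSum_add_gauge hw 0).unique hshift (by simp)
  refine ⟨-b, Prod.ext ?_ ?_⟩
  · rw [neg_smul]
    exact eq_neg_of_add_eq_zero_left (congrArg Prod.fst hzero)
  · rw [neg_neg]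
    exact sub_eq_zero.1 (congrArg Prod.snd hzero)

end Linearization

section Smoothness

variable (ν₀ : Measure X) (ν₁ : Measure Y) [IsProbabilityMeasure ν₀] [IsProbabilityMeasure ν₁]

/-- The left-hand side of the Schrödinger system together with the normalization of the
potentials, as a function of the exponent and the potentials. -/
def schrodingerMap (q : C(X × Y, ℝ) × (C(X, ℝ) × C(Y, ℝ))) : C(X, ℝ) × C(Y, ℝ) :=
  marginals ν₀ ν₁ (gibbs q.1 q.2) + gauge ν₁ q.2

theorem contDiff_schrodingerMap {n : WithTop ℕ∞} :
    ContDiff ℝ n (schrodingerMap (X := X) (Y := Y) ν₀ ν₁) :=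
  ((marginals ν₀ ν₁).contDiff.comp contDiff_gibbs).add
    (gauge ν₁ ∘L ContinuousLinearMap.snd ℝ C(X × Y, ℝ) (C(X, ℝ) × C(Y, ℝ))).contDiff

theorem fderiv_schrodingerMap_comp_inr (k : C(X × Y, ℝ)) (w h : C(X, ℝ) × C(Y, ℝ)) :
    (fderiv ℝ (schrodingerMap ν₀ ν₁) (k, w) ∘L ContinuousLinearMap.inr ℝ _ _) h =
      marginals ν₀ ν₁ (gibbs k w * directSum h) + gauge ν₁ h := by
  have hderiv : HasFDerivAt (schrodingerMap ν₀ ν₁) _ (k, w) :=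
    ((marginals ν₀ ν₁).hasFDerivAt.comp (k, w) (hasFDerivAt_gibbs k w)).add
      (gauge ν₁ ∘L ContinuousLinearMap.snd ℝ C(X × Y, ℝ) (C(X, ℝ) × C(Y, ℝ))).hasFDerivAt
  rw [hderiv.fderiv]
  simp

variable [SecondCountableTopologyEither X Y]

variable {ν₀ ν₁} in
theorem schrodingerMap_eq_one_iff {k : C(X × Y, ℝ)} {w : C(X, ℝ) × C(Y, ℝ)} :
    schrodingerMap ν₀ ν₁ (k, w) = 1 ↔ w = potentials ν₀ ν₁ k := by
  rw [schrodingerMap, marginals_add_gauge_eq_iff (by simp)]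
  refine ⟨fun h => eq_potentials h.1 h.2, ?_⟩
  rintro rfl
  exact ⟨marginals_optimalDensity ν₀ ν₁ k, integralL_potentials_snd ν₀ ν₁ k⟩

theorem isInvertible_fderiv_schrodingerMap_comp_inr (k : C(X × Y, ℝ)) :
    (fderiv ℝ (schrodingerMap ν₀ ν₁) (k, potentials ν₀ ν₁ k) ∘L
      ContinuousLinearMap.inr ℝ _ _).IsInvertible := by
  have hbij : Function.Bijective (fderiv ℝ (schrodingerMap ν₀ ν₁) (k, potentials ν₀ ν₁ k) ∘L
      ContinuousLinearMap.inr ℝ _ _) := by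
    simp only [Function.bijective_iff_existsUnique, fderiv_schrodingerMap_comp_inr]
    exact existsUnique_marginals_mul_directSum_add_gauge (marginals_optimalDensity ν₀ ν₁ k)
  exact ⟨ContinuousLinearEquiv.ofBijective _ (LinearMap.ker_eq_bot.2 hbij.1)
    (LinearMap.range_eq_top.2 hbij.2), ContinuousLinearEquiv.coe_ofBijective _ _ _⟩

theorem contDiff_potentials : ContDiff ℝ ∞ (potentials (X := X) (Y := Y) ν₀ ν₁) := by
  refine contDiff_iff_contDiffAt.2 fun k => ?_
  have hF : ContDiffAt ℝ ∞ (schrodingerMap ν₀ ν₁) (k, potentials ν₀ ν₁ k) :=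
    (contDiff_schrodingerMap ν₀ ν₁).contDiffAt
  have hn : (∞ : WithTop ℕ∞) ≠ 0 := by simp
  have hinv := isInvertible_fderiv_schrodingerMap_comp_inr ν₀ ν₁ k
  refine (hF.contDiffAt_implicitFunction hn hinv).congr_of_eventuallyEq ?_
  filter_upwards [hF.eventually_apply_implicitFunction hn hinv] with k' hk'
  rw [schrodingerMap_eq_one_iff.2 rfl, schrodingerMap_eq_one_iff] at hk'
  exact hk'.symm

theorem contDiff_optimalDensity : ContDiff ℝ ∞ (optimalDensity (X := X) (Y := Y) ν₀ ν₁) :=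
  contDiff_gibbs.comp (contDiff_id.prodMk (contDiff_potentials ν₀ ν₁))

variable (k κ : C(X × Y, ℝ))

theorem fderiv_optimalDensity_eq_mul_fderiv_potentials :
    fderiv ℝ (optimalDensity ν₀ ν₁) k κ =
      optimalDensity ν₀ ν₁ k * (directSum (fderiv ℝ (potentials ν₀ ν₁) k κ) + κ) := by
  have hpot : HasFDerivAt (potentials ν₀ ν₁) (fderiv ℝ (potentials ν₀ ν₁) k) k :=
    ((contDiff_potentials ν₀ ν₁).differentiable (by simp) k).hasFDerivAt
  have hderiv := (hasFDerivAt_gibbs k (potentials ν₀ ν₁ k)).comp k ((hasFDerivAt_id k).prodMk hpot)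
  change HasFDerivAt (optimalDensity ν₀ ν₁) _ k at hderiv
  rw [hderiv.fderiv]
  rfl

theorem marginals_fderiv_optimalDensity :
    marginals ν₀ ν₁ (fderiv ℝ (optimalDensity ν₀ ν₁) k κ) = 0 := by
  have hderiv := (marginals ν₀ ν₁).hasFDerivAt.comp k
    ((contDiff_optimalDensity ν₀ ν₁).differentiable (by simp) k).hasFDerivAt
  have hconst : marginals ν₀ ν₁ ∘ optimalDensity ν₀ ν₁ = fun _ => 1 :=
    funext (marginals_optimalDensity ν₀ ν₁)
  rw [hconst] at hderiv
  exact DFunLike.congr_fun (hderiv.unique (hasFDerivAt_const _ _)) κ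

variable {ν₀ ν₁ k κ} in
theorem fderiv_optimalDensity_apply {h : C(X, ℝ) × C(Y, ℝ)}
    (hh : marginals ν₀ ν₁ (optimalDensity ν₀ ν₁ k * (directSum h + κ)) = 0) :
    fderiv ℝ (optimalDensity ν₀ ν₁) k κ = optimalDensity ν₀ ν₁ k * (directSum h + κ) := by
  set d := fderiv ℝ (potentials ν₀ ν₁) k κ
  have hd := marginals_fderiv_optimalDensity ν₀ ν₁ k κ
  rw [fderiv_optimalDensity_eq_mul_fderiv_potentials] at hd ⊢
  have hdiff : marginals ν₀ ν₁ (optimalDensity ν₀ ν₁ k * directSum (d - h)) = 0 := by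
    rw [map_sub, ← add_sub_add_right_eq_sub _ _ κ, mul_sub, map_sub, hd, hh, sub_zero]
  obtain ⟨a, ha⟩ := exists_eq_const_of_marginals_gibbs_mul_eq_zero
    (marginals_optimalDensity ν₀ ν₁ k) hdiff
  have hsum : directSum (d - h) = 0 := by
    rw [ha]
    ext z
    simp
  rw [map_sub, sub_eq_zero] at hsum
  rw [hsum]

/-- The optimal value of the dual problem, in units of the regularization parameter. -/
def dualValue (k : C(X × Y, ℝ)) : ℝ :=
  integralL ν₀ (potentials ν₀ ν₁ k).1 + integralL ν₁ (potentials ν₀ ν₁ k).2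

theorem contDiff_dualValue : ContDiff ℝ ∞ (dualValue (X := X) (Y := Y) ν₀ ν₁) :=
  ((integralL ν₀).contDiff.comp (contDiff_potentials ν₀ ν₁).fst).add
    ((integralL ν₁).contDiff.comp (contDiff_potentials ν₀ ν₁).snd)

variable {ν₀ ν₁ k} in
theorem dualValue_eq {w : C(X, ℝ) × C(Y, ℝ)} (hw : marginals ν₀ ν₁ (gibbs k w) = 1) :
    dualValue ν₀ ν₁ k = integralL ν₀ w.1 + integralL ν₁ w.2 := by
  rw [dualValue, ← integralL_mul_directSum hw, ← integralL_mul_directSum hw,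
    directSum_eq_directSum_potentials hw]

/-- The envelope theorem: the response of the potentials is eliminated by the constancy of the mass
of the optimal density. -/
theorem fderiv_dualValue_apply :
    fderiv ℝ (dualValue ν₀ ν₁) k κ = -integralL (ν₀.prod ν₁) (optimalDensity ν₀ ν₁ k * κ) := by
  have hpot : HasFDerivAt (potentials ν₀ ν₁) (fderiv ℝ (potentials ν₀ ν₁) k) k :=
    ((contDiff_potentials ν₀ ν₁).differentiable (by simp) k).hasFDerivAt
  have hderiv : HasFDerivAt (dualValue ν₀ ν₁) _ k :=
    ((integralL ν₀).hasFDerivAt.comp k hpot.fst).add ((integralL ν₁).hasFDerivAt.comp k hpot.snd)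
  have hmass : integralL (ν₀.prod ν₁) (fderiv ℝ (optimalDensity ν₀ ν₁) k κ) = 0 := by
    rw [← integralL_marginals_fst, marginals_fderiv_optimalDensity, Prod.fst_zero, map_zero]
  rw [fderiv_optimalDensity_eq_mul_fderiv_potentials, mul_add, map_add,
    integralL_mul_directSum (marginals_optimalDensity ν₀ ν₁ k)] at hmass
  rw [hderiv.fderiv]
  exact eq_neg_of_add_eq_zero_left hmass

theorem norm_fderiv_dualValue_le : ‖fderiv ℝ (dualValue ν₀ ν₁) k‖ ≤ 1 := by
  refine ContinuousLinearMap.opNorm_le_bound _ zero_le_one fun κ => ?_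
  have hmass : integralL (ν₀.prod ν₁) (optimalDensity ν₀ ν₁ k) = 1 := by
    rw [← integralL_marginals_fst, marginals_optimalDensity, Prod.fst_one, integralL_one]
  have hbound : ∀ z, ‖(optimalDensity ν₀ ν₁ k * κ) z‖ ≤ optimalDensity ν₀ ν₁ k z * ‖κ‖ := by
    intro z
    have hpos : 0 ≤ optimalDensity ν₀ ν₁ k z := by
      rw [optimalDensity, gibbs_apply]
      positivity
    rw [ContinuousMap.mul_apply, norm_mul, Real.norm_of_nonneg hpos]
    exact mul_le_mul_of_nonneg_left (κ.norm_coe_le_norm z) hpos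
  rw [fderiv_dualValue_apply, norm_neg, ← hmass, integralL_apply, integralL_apply,
    ← integral_mul_const]
  exact norm_integral_le_of_norm_le ((integrable_continuousMap _ _).mul_const _)
    (ae_of_all _ hbound)

theorem lipschitzWith_dualValue : LipschitzWith 1 (dualValue (X := X) (Y := Y) ν₀ ν₁) :=
  lipschitzWith_of_nnnorm_fderiv_le ((contDiff_dualValue ν₀ ν₁).differentiable (by simp))
    (norm_fderiv_dualValue_le ν₀ ν₁)

end Smoothness

end SchrodingerSystem

section KullbackLeibler

variable {Z : Type*} [MeasurableSpace Z] {π μ : Measure Z} {f : Z → ℝ}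

theorem integrable_llr_tilted_right_iff [IsFiniteMeasure π] [SigmaFinite μ] (hac : π ≪ μ)
    (hf : Integrable f π) (hexp : Integrable (fun z => Real.exp (f z)) μ) :
    Integrable (llr π (μ.tilted f)) π ↔ Integrable (llr π μ) π := by
  refine ⟨fun h => ?_, fun h => integrable_llr_tilted_right hac hf h hexp⟩
  refine ((h.add hf).sub (integrable_const (Real.log (∫ z, Real.exp (f z) ∂μ)))).congr ?_
  filter_upwards [llr_tilted_right hac hexp] with z hz
  simp only [Pi.sub_apply, Pi.add_apply, hz]
  ring

theorem klDiv_eq_klDiv_tilted_add [IsProbabilityMeasure π] [IsProbabilityMeasure μ]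
    (hf : Integrable f π) (hexp : Integrable (fun z => Real.exp (f z)) μ) :
    (klDiv π μ : EReal) = klDiv π (μ.tilted f) +
      ((∫ z, f z ∂π - Real.log (∫ z, Real.exp (f z) ∂μ) : ℝ) : EReal) := by
  have := isProbabilityMeasure_tilted hexp
  by_cases hac : π ≪ μ
  · have hac' : π ≪ μ.tilted f := hac.trans (absolutelyContinuous_tilted hexp)
    by_cases hllr : Integrable (llr π μ) π
    · have hllr' := (integrable_llr_tilted_right_iff hac hf hexp).2 hllr
      rw [← EReal.coe_ennreal_toReal (klDiv_ne_top hac hllr),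
        ← EReal.coe_ennreal_toReal (klDiv_ne_top hac' hllr'),
        toReal_klDiv_of_measure_eq hac (by simp), toReal_klDiv_of_measure_eq hac' (by simp),
        integral_llr_tilted_right hac hf hexp hllr]
      norm_cast
      ring
    · rw [klDiv_of_not_integrable hllr,
        klDiv_of_not_integrable (mt (integrable_llr_tilted_right_iff hac hf hexp).1 hllr),
        EReal.coe_ennreal_top, EReal.top_add_coe]
  · rw [klDiv_of_not_ac hac,
      klDiv_of_not_ac (mt (fun h => h.trans (tilted_absolutelyContinuous _ _)) hac),
      EReal.coe_ennreal_top, EReal.top_add_coe]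

theorem lintegral_ofReal_exp_eq_one (hf : ∫ z, Real.exp (f z) ∂μ = 1) :
    ∫⁻ z, ENNReal.ofReal (Real.exp (f z)) ∂μ = 1 := by
  rw [← ofReal_integral_eq_lintegral_ofReal (.of_integral_ne_zero (by simp [hf]))
    (ae_of_all _ fun z => (Real.exp_pos _).le), hf, ENNReal.ofReal_one]

end KullbackLeibler

section Couplings

variable {X Y : Type*} [MeasurableSpace X] [MeasurableSpace Y] {μ₀ : Measure X} {μ₁ : Measure Y}
  {π : Measure (X × Y)}

theorem isProbabilityMeasure_of_mem_couplings [IsProbabilityMeasure μ₀]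
    (hπ : π ∈ couplings μ₀ μ₁) : IsProbabilityMeasure π := by
  have : IsProbabilityMeasure (π.map Prod.fst) := by
    rw [hπ.1]
    infer_instance
  exact Measure.isProbabilityMeasure_of_map Prod.fst

theorem prod_mem_couplings [IsProbabilityMeasure μ₀] [IsProbabilityMeasure μ₁] :
    μ₀.prod μ₁ ∈ couplings μ₀ μ₁ := by
  constructor <;> simp [Measure.map_fst_prod, Measure.map_snd_prod]

theorem integral_comp_fst (hπ : π ∈ couplings μ₀ μ₁) {f : X → ℝ}
    (hf : AEStronglyMeasurable f μ₀) : ∫ z, f z.1 ∂π = ∫ x, f x ∂μ₀ := by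
  rw [← hπ.1] at hf ⊢
  exact (integral_map measurable_fst.aemeasurable hf).symm

theorem integral_comp_snd (hπ : π ∈ couplings μ₀ μ₁) {f : Y → ℝ}
    (hf : AEStronglyMeasurable f μ₁) : ∫ z, f z.2 ∂π = ∫ y, f y ∂μ₁ := by
  rw [← hπ.2] at hf ⊢
  exact (integral_map measurable_snd.aemeasurable hf).symm

theorem withDensity_mem_couplings [SFinite μ₀] [SFinite μ₁] {g : X × Y → ENNReal}
    (hg : Measurable g) (hfst : ∀ x, ∫⁻ y, g (x, y) ∂μ₁ = 1) (hsnd : ∀ y, ∫⁻ x, g (x, y) ∂μ₀ = 1) :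
    (μ₀.prod μ₁).withDensity g ∈ couplings μ₀ μ₁ := by
  constructor <;> ext s hs
  · rw [Measure.map_apply measurable_fst hs, withDensity_apply _ (measurable_fst hs),
      ← Set.prod_univ, ← Measure.prod_restrict, Measure.restrict_univ,
      lintegral_prod _ hg.aemeasurable]
    simp [hfst]
  · rw [Measure.map_apply measurable_snd hs, withDensity_apply _ (measurable_snd hs),
      ← Set.univ_prod, ← Measure.prod_restrict, Measure.restrict_univ,
      lintegral_prod_symm _ hg.aemeasurable]
    simp [hsnd]

variable [TopologicalSpace X] [SecondCountableTopology X] [TopologicalSpace Y]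
  [SecondCountableTopology Y]

theorem ae_mem_support_of_mem_couplings (hπ : π ∈ couplings μ₀ μ₁) :
    ∀ᵐ z ∂π, z ∈ μ₀.support ×ˢ μ₁.support := by
  have h₀ : ∀ᵐ x ∂π.map Prod.fst, x ∈ μ₀.support := by
    rw [hπ.1]
    exact Measure.support_mem_ae
  have h₁ : ∀ᵐ y ∂π.map Prod.snd, y ∈ μ₁.support := by
    rw [hπ.2]
    exact Measure.support_mem_ae
  filter_upwards [ae_of_ae_map measurable_fst.aemeasurable h₀,
    ae_of_ae_map measurable_snd.aemeasurable h₁] with z hz₀ hz₁ using ⟨hz₀, hz₁⟩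

theorem integrable_of_mem_couplings [T2Space X] [BorelSpace X] [T2Space Y] [BorelSpace Y]
    [IsProbabilityMeasure μ₀] (h₀ : IsCompact μ₀.support) (h₁ : IsCompact μ₁.support)
    (hπ : π ∈ couplings μ₀ μ₁) {f : X × Y → ℝ} (hf : Continuous f) : Integrable f π := by
  have := isProbabilityMeasure_of_mem_couplings hπ
  have hon := hf.continuousOn.integrableOn_compact' (μ := π) (h₀.prod h₁)
    (h₀.prod h₁).measurableSet
  rwa [IntegrableOn, Measure.restrict_eq_self_of_ae_mem (ae_mem_support_of_mem_couplings hπ)]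
    at hon

end Couplings

section Duality

variable {X Y : Type*} [TopologicalSpace X] [MeasurableSpace X] [TopologicalSpace Y]
  [MeasurableSpace Y] {μ₀ : Measure X} {μ₁ : Measure Y} {c : X → Y → ℝ} {ε : ℝ} {φ₀ : X → ℝ}
  {φ₁ : Y → ℝ} {π : Measure (X × Y)}

/-- The exponent of the Gibbs density of a pair of potentials. -/
def gibbsExponent (c : X → Y → ℝ) (ε : ℝ) (φ₀ : X → ℝ) (φ₁ : Y → ℝ) (z : X × Y) : ℝ :=
  (φ₀ z.1 + φ₁ z.2 - c z.1 z.2) / ε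

/-- The coupling whose density with respect to `μ₀ ⊗ μ₁` is the Gibbs density of a pair of
potentials. -/
def gibbsCoupling (μ₀ : Measure X) (μ₁ : Measure Y) (c : X → Y → ℝ) (ε : ℝ) (φ₀ : X → ℝ)
    (φ₁ : Y → ℝ) : Measure (X × Y) :=
  (μ₀.prod μ₁).tilted (gibbsExponent c ε φ₀ φ₁)

theorem continuous_gibbsExponent (hc : Continuous (Function.uncurry c))
    (hφ : IsEOTPotentials μ₀ μ₁ c ε φ₀ φ₁) : Continuous (gibbsExponent c ε φ₀ φ₁) :=
  (((hφ.continuous_fst.comp continuous_fst).add (hφ.continuous_snd.comp continuous_snd)).sub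
    hc).div_const ε

variable [T2Space X] [SecondCountableTopology X] [BorelSpace X] [T2Space Y]
  [SecondCountableTopology Y] [BorelSpace Y] [IsProbabilityMeasure μ₀]

theorem mul_integral_gibbsExponent (h₀ : IsCompact μ₀.support) (h₁ : IsCompact μ₁.support)
    (hc : Continuous (Function.uncurry c)) (hε : ε ≠ 0) (hφ : IsEOTPotentials μ₀ μ₁ c ε φ₀ φ₁)
    (hπ : π ∈ couplings μ₀ μ₁) :
    ε * ∫ z, gibbsExponent c ε φ₀ φ₁ z ∂π =
      ∫ x, φ₀ x ∂μ₀ + ∫ y, φ₁ y ∂μ₁ - ∫ z, c z.1 z.2 ∂π := by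
  have hi₀ : Integrable (fun z => φ₀ z.1) π :=
    integrable_of_mem_couplings h₀ h₁ hπ (hφ.continuous_fst.comp continuous_fst)
  have hi₁ : Integrable (fun z => φ₁ z.2) π :=
    integrable_of_mem_couplings h₀ h₁ hπ (hφ.continuous_snd.comp continuous_snd)
  have hic : Integrable (fun z => c z.1 z.2) π := integrable_of_mem_couplings h₀ h₁ hπ hc
  rw [← integral_comp_fst hπ hφ.continuous_fst.aestronglyMeasurable,
    ← integral_comp_snd hπ hφ.continuous_snd.aestronglyMeasurable, ← integral_add hi₀ hi₁,
    ← integral_sub (by exact hi₀.add hi₁) hic, ← integral_const_mul]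
  simp only [gibbsExponent, mul_div_cancel₀ _ hε]

variable [IsProbabilityMeasure μ₁]

theorem integrable_exp_gibbsExponent (h₀ : IsCompact μ₀.support) (h₁ : IsCompact μ₁.support)
    (hc : Continuous (Function.uncurry c)) (hφ : IsEOTPotentials μ₀ μ₁ c ε φ₀ φ₁) :
    Integrable (fun z => Real.exp (gibbsExponent c ε φ₀ φ₁ z)) (μ₀.prod μ₁) :=
  integrable_of_mem_couplings h₀ h₁ prod_mem_couplings
    (Real.continuous_exp.comp (continuous_gibbsExponent hc hφ))

theorem integral_exp_gibbsExponent (h₀ : IsCompact μ₀.support) (h₁ : IsCompact μ₁.support)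
    (hc : Continuous (Function.uncurry c)) (hφ : IsEOTPotentials μ₀ μ₁ c ε φ₀ φ₁) :
    ∫ z, Real.exp (gibbsExponent c ε φ₀ φ₁ z) ∂μ₀.prod μ₁ = 1 := by
  rw [integral_prod _ (integrable_exp_gibbsExponent h₀ h₁ hc hφ)]
  simp [gibbsExponent, hφ.system_fst]

theorem integral_gibbsCoupling (h₀ : IsCompact μ₀.support) (h₁ : IsCompact μ₁.support)
    (hc : Continuous (Function.uncurry c)) (hφ : IsEOTPotentials μ₀ μ₁ c ε φ₀ φ₁)
    (f : X × Y → ℝ) :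
    ∫ z, f z ∂gibbsCoupling μ₀ μ₁ c ε φ₀ φ₁ =
      ∫ z, Real.exp (gibbsExponent c ε φ₀ φ₁ z) * f z ∂μ₀.prod μ₁ := by
  rw [gibbsCoupling, integral_tilted]
  simp [integral_exp_gibbsExponent h₀ h₁ hc hφ]

theorem gibbsCoupling_mem_couplings (h₀ : IsCompact μ₀.support) (h₁ : IsCompact μ₁.support)
    (hc : Continuous (Function.uncurry c)) (hφ : IsEOTPotentials μ₀ μ₁ c ε φ₀ φ₁) :
    gibbsCoupling μ₀ μ₁ c ε φ₀ φ₁ ∈ couplings μ₀ μ₁ := by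
  rw [gibbsCoupling, Measure.tilted, integral_exp_gibbsExponent h₀ h₁ hc hφ]
  simp only [div_one]
  exact withDensity_mem_couplings
    (Real.continuous_exp.comp (continuous_gibbsExponent hc hφ)).measurable.ennreal_ofReal
    (fun x => lintegral_ofReal_exp_eq_one (hφ.system_fst x))
    (fun y => lintegral_ofReal_exp_eq_one (hφ.system_snd y))

theorem eotObjective_eq (h₀ : IsCompact μ₀.support) (h₁ : IsCompact μ₁.support)
    (hc : Continuous (Function.uncurry c)) (hε : 0 < ε)
    (hφ : IsEOTPotentials μ₀ μ₁ c ε φ₀ φ₁) (hπ : π ∈ couplings μ₀ μ₁) :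
    eotObjective μ₀ μ₁ c ε π = ((∫ x, φ₀ x ∂μ₀ + ∫ y, φ₁ y ∂μ₁ : ℝ) : EReal) +
      (ε : EReal) * (klDiv π (gibbsCoupling μ₀ μ₁ c ε φ₀ φ₁) : EReal) := by
  have := isProbabilityMeasure_of_mem_couplings hπ
  have hexponent : Integrable (gibbsExponent c ε φ₀ φ₁) π :=
    integrable_of_mem_couplings h₀ h₁ hπ (continuous_gibbsExponent hc hφ)
  rw [eotObjective,
    klDiv_eq_klDiv_tilted_add hexponent (integrable_exp_gibbsExponent h₀ h₁ hc hφ),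
    integral_exp_gibbsExponent h₀ h₁ hc hφ, Real.log_one, sub_zero,
    EReal.left_distrib_of_nonneg_of_ne_top (EReal.coe_nonneg.2 hε.le) (EReal.coe_ne_top ε),
    add_left_comm, add_comm, ← EReal.coe_mul, mul_integral_gibbsExponent h₀ h₁ hc hε.ne' hφ hπ,
    ← EReal.coe_add, add_sub_cancel]
  rfl

theorem eotCost_eq (h₀ : IsCompact μ₀.support) (h₁ : IsCompact μ₁.support)
    (hc : Continuous (Function.uncurry c)) (hε : 0 < ε)
    (hφ : IsEOTPotentials μ₀ μ₁ c ε φ₀ φ₁) :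
    eotCost μ₀ μ₁ c ε = ((∫ x, φ₀ x ∂μ₀ + ∫ y, φ₁ y ∂μ₁ : ℝ) : EReal) := by
  have hγ := gibbsCoupling_mem_couplings h₀ h₁ hc hφ
  have := isProbabilityMeasure_of_mem_couplings hγ
  refine le_antisymm ((iInf₂_le _ hγ).trans ?_) (le_iInf₂ fun π hπ => ?_)
  · rw [eotObjective_eq h₀ h₁ hc hε hφ hγ, klDiv_self]
    simp
  · rw [eotObjective_eq h₀ h₁ hc hε hφ hπ]
    exact le_add_of_nonneg_right
      (mul_nonneg (EReal.coe_nonneg.2 hε.le) (EReal.coe_ennreal_nonneg _))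

theorem isEOTCoupling_iff (h₀ : IsCompact μ₀.support) (h₁ : IsCompact μ₁.support)
    (hc : Continuous (Function.uncurry c)) (hε : 0 < ε)
    (hφ : IsEOTPotentials μ₀ μ₁ c ε φ₀ φ₁) :
    IsEOTCoupling μ₀ μ₁ c ε π ↔ π = gibbsCoupling μ₀ μ₁ c ε φ₀ φ₁ := by
  have hγ := gibbsCoupling_mem_couplings h₀ h₁ hc hφ
  have := isProbabilityMeasure_of_mem_couplings hγ
  constructor
  · rintro ⟨hπ, hmin⟩
    have := isProbabilityMeasure_of_mem_couplings hπ
    rw [eotObjective_eq h₀ h₁ hc hε hφ hπ, eotCost_eq h₀ h₁ hc hε hφ] at hmin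
    rw [← klDiv_eq_zero_iff]
    by_contra hne
    have hpos : (0 : EReal) < ε * (klDiv π (gibbsCoupling μ₀ μ₁ c ε φ₀ φ₁) : EReal) :=
      EReal.mul_pos (EReal.coe_pos.2 hε) (EReal.coe_ennreal_pos.2 (pos_iff_ne_zero.2 hne))
    have hlt := EReal.add_lt_add_left_coe hpos (∫ x, φ₀ x ∂μ₀ + ∫ y, φ₁ y ∂μ₁)
    rw [hmin, add_zero] at hlt
    exact hlt.false
  · rintro rfl
    refine ⟨hγ, ?_⟩
    rw [eotObjective_eq h₀ h₁ hc hε hφ hγ, eotCost_eq h₀ h₁ hc hε hφ, klDiv_self]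
    simp

end Duality

section SupportMeasure

variable {X Y : Type*} [TopologicalSpace X] [MeasurableSpace X] [BorelSpace X]
  [TopologicalSpace Y] [MeasurableSpace Y] [BorelSpace Y]

theorem measurableEmbedding_support (μ : Measure X) :
    MeasurableEmbedding (Subtype.val : μ.support → X) :=
  .subtype_coe μ.isClosed_support.measurableSet

/-- A measure, viewed on its support. -/
def supportMeasure (μ : Measure X) : Measure μ.support := μ.comap Subtype.val

variable [SecondCountableTopology X] [SecondCountableTopology Y]

theorem measurePreserving_supportMeasure (μ : Measure X) :
    MeasurePreserving (Subtype.val : μ.support → X) (supportMeasure μ) μ := by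
  refine ⟨measurable_subtype_coe, ?_⟩
  rw [supportMeasure, map_comap_subtype_coe μ.isClosed_support.measurableSet]
  exact Measure.restrict_eq_self_of_ae_mem Measure.support_mem_ae

instance (μ : Measure X) [IsProbabilityMeasure μ] : IsProbabilityMeasure (supportMeasure μ) := by
  have h := (measurePreserving_supportMeasure μ).map_eq
  have : IsProbabilityMeasure ((supportMeasure μ).map Subtype.val) := by rwa [h]
  exact Measure.isProbabilityMeasure_of_map Subtype.val

theorem integral_supportMeasure (μ : Measure X) (f : X → ℝ) :
    ∫ x, f x.1 ∂supportMeasure μ = ∫ x, f x ∂μ :=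
  (measurePreserving_supportMeasure μ).integral_comp (measurableEmbedding_support μ) f

theorem integral_prod_supportMeasure (μ₀ : Measure X) (μ₁ : Measure Y) [IsProbabilityMeasure μ₀]
    [IsProbabilityMeasure μ₁] (f : X × Y → ℝ) :
    ∫ z, f (z.1, z.2) ∂(supportMeasure μ₀).prod (supportMeasure μ₁) = ∫ z, f z ∂μ₀.prod μ₁ :=
  ((measurePreserving_supportMeasure μ₀).prod (measurePreserving_supportMeasure μ₁)).integral_comp
    ((measurableEmbedding_support μ₀).prodMap (measurableEmbedding_support μ₁)) f

end SupportMeasure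

section SoftTransform

variable {X Y : Type*} [TopologicalSpace X] [TopologicalSpace Y] [MeasurableSpace Y]
  {μ₁ : Measure Y} {c : X → Y → ℝ} {ε : ℝ}

/-- The soft `c`-transform of the potential `ε v`: the function on the whole space that solves one
of the Schrödinger equations when `ε v` is the potential on the support of the other marginal. -/
def softTransform (μ₁ : Measure Y) (c : X → Y → ℝ) (ε : ℝ) (v : C(μ₁.support, ℝ)) (x : X) : ℝ :=
  -ε * Real.log (∫ y : μ₁.support, Real.exp (v y - c x y / ε) ∂supportMeasure μ₁)

variable [SecondCountableTopology Y] [BorelSpace Y] [IsProbabilityMeasure μ₁]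
  [CompactSpace μ₁.support]

theorem integral_exp_sub_pos (hc : Continuous (Function.uncurry c)) (v : C(μ₁.support, ℝ))
    (x : X) : 0 < ∫ y : μ₁.support, Real.exp (v y - c x y / ε) ∂supportMeasure μ₁ :=
  integral_exp_pos (integrable_exp_continuousMap _ ⟨fun y => v y - c x y / ε, v.continuous.sub
    ((hc.comp (continuous_const.prodMk continuous_subtype_val)).div_const ε)⟩)

theorem continuous_softTransform [FirstCountableTopology X] [LocallyCompactSpace X]
    (hc : Continuous (Function.uncurry c)) (v : C(μ₁.support, ℝ)) :
    Continuous (softTransform μ₁ c ε v) := by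
  have h := continuous_parametric_integral_of_continuous (μ := supportMeasure μ₁)
    (f := fun (x : X) (y : μ₁.support) => Real.exp (v y - c x y / ε)) (s := Set.univ)
    (Real.continuous_exp.comp ((v.continuous.comp continuous_snd).sub
      ((hc.comp (continuous_fst.prodMk (continuous_subtype_val.comp continuous_snd))).div_const ε)))
    isCompact_univ
  simp only [Measure.restrict_univ] at h
  exact continuous_const.mul (h.log fun x => (integral_exp_sub_pos hc v x).ne')

theorem softTransform_div_eq_iff (hc : Continuous (Function.uncurry c)) (hε : ε ≠ 0)
    (v : C(μ₁.support, ℝ)) (x : X) (t : ℝ) :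
    softTransform μ₁ c ε v x / ε = t ↔
      ∫ y : μ₁.support, Real.exp (t + v y - c x y / ε) ∂supportMeasure μ₁ = 1 := by
  have hpos := integral_exp_sub_pos (ε := ε) hc v x
  simp only [add_sub_assoc, Real.exp_add t, integral_const_mul]
  rw [softTransform, neg_mul, neg_div, mul_div_cancel_left₀ _ hε, neg_eq_iff_add_eq_zero,
    add_comm]
  conv_rhs => rw [← Real.exp_log hpos, ← Real.exp_add, Real.exp_eq_one_iff]

end SoftTransform

section Restriction

variable {X Y : Type*} [TopologicalSpace X] [MeasurableSpace X] [TopologicalSpace Y]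
  [MeasurableSpace Y] {μ₀ : Measure X} {μ₁ : Measure Y} {c : X → Y → ℝ} {ε : ℝ}
  {k : C(μ₀.support × μ₁.support, ℝ)} {φ₀ : X → ℝ} {φ₁ : Y → ℝ}

/-- The restrictions to the supports of a pair of potentials, divided by `ε`: the form in which
potentials enter `gibbs`. -/
def restrictPotentials (hφ : IsEOTPotentials μ₀ μ₁ c ε φ₀ φ₁) :
    C(μ₀.support, ℝ) × C(μ₁.support, ℝ) :=
  (⟨fun x => φ₀ x / ε, (hφ.continuous_fst.comp continuous_subtype_val).div_const ε⟩,
    ⟨fun y => φ₁ y / ε, (hφ.continuous_snd.comp continuous_subtype_val).div_const ε⟩)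

variable [CompactSpace μ₀.support] [CompactSpace μ₁.support]

theorem gibbs_restrictPotentials (hk : ∀ z, k z = -(c z.1 z.2) / ε)
    (hφ : IsEOTPotentials μ₀ μ₁ c ε φ₀ φ₁) (z : μ₀.support × μ₁.support) :
    gibbs k (restrictPotentials hφ) z = Real.exp (gibbsExponent c ε φ₀ φ₁ (z.1, z.2)) := by
  rw [gibbs_apply, hk]
  change Real.exp (φ₀ z.1 / ε + φ₁ z.2 / ε + _) = Real.exp ((φ₀ z.1 + φ₁ z.2 - c z.1 z.2) / ε)
  congr 1
  ring

variable [SecondCountableTopology X] [BorelSpace X] [SecondCountableTopology Y] [BorelSpace Y]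
  [IsProbabilityMeasure μ₀] [IsProbabilityMeasure μ₁]

theorem marginals_gibbs_restrictPotentials (hk : ∀ z, k z = -(c z.1 z.2) / ε)
    (hφ : IsEOTPotentials μ₀ μ₁ c ε φ₀ φ₁) :
    marginals (supportMeasure μ₀) (supportMeasure μ₁) (gibbs k (restrictPotentials hφ)) = 1 := by
  ext z
  · simp only [marginals_fst_apply, gibbs_restrictPotentials hk]
    exact (integral_supportMeasure μ₁ _).trans (hφ.system_fst z)
  · simp only [marginals_snd_apply, gibbs_restrictPotentials hk]
    exact (integral_supportMeasure μ₀ fun x => Real.exp (gibbsExponent c ε φ₀ φ₁ (x, z))).trans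
      (hφ.system_snd z)

theorem exists_isEOTPotentials [LocallyCompactSpace X] [LocallyCompactSpace Y]
    (hc : Continuous (Function.uncurry c)) (hε : ε ≠ 0) :
    ∃ φ₀ φ₁, IsEOTPotentials μ₀ μ₁ c ε φ₀ φ₁ := by
  have hc' : Continuous (Function.uncurry fun y x => c x y) := hc.comp continuous_swap
  let k : C(μ₀.support × μ₁.support, ℝ) := ⟨fun z => -(c z.1 z.2) / ε,
    (hc.comp (continuous_subtype_val.prodMap continuous_subtype_val)).neg.div_const ε⟩
  obtain ⟨w, ⟨hw, -⟩, -⟩ := existsUnique_potentials (supportMeasure μ₀) (supportMeasure μ₁) k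
  have hfst (x : μ₀.support) : softTransform μ₁ c ε w.2 x / ε = w.1 x := by
    rw [softTransform_div_eq_iff hc hε]
    simpa [marginals_fst_apply, gibbs_apply, k, neg_div, ← sub_eq_add_neg] using
      DFunLike.congr_fun (congrArg Prod.fst hw) x
  have hsnd (y : μ₁.support) : softTransform μ₀ (fun y x => c x y) ε w.1 y / ε = w.2 y := by
    rw [softTransform_div_eq_iff hc' hε]
    simpa [marginals_snd_apply, gibbs_apply, k, neg_div, ← sub_eq_add_neg,
      add_comm (w.2 y)] using
      DFunLike.congr_fun (congrArg Prod.snd hw) y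
  refine ⟨softTransform μ₁ c ε w.2, softTransform μ₀ (fun y x => c x y) ε w.1,
    continuous_softTransform hc _, continuous_softTransform hc' _, fun x => ?_, fun y => ?_⟩
  · rw [← integral_supportMeasure, ← (softTransform_div_eq_iff hc hε w.2 x _).1 rfl]
    simp only [add_div, sub_div, hsnd]
  · rw [← integral_supportMeasure, ← (softTransform_div_eq_iff hc' hε w.1 y _).1 rfl]
    simp only [add_div, sub_div, hfst, add_comm (w.1 _)]

variable [T2Space X] [T2Space Y]

theorem eotCost_eq_dualValue [LocallyCompactSpace X] [LocallyCompactSpace Y]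
    (hc : Continuous (Function.uncurry c)) (hε : 0 < ε) (hk : ∀ z, k z = -(c z.1 z.2) / ε) :
    eotCost μ₀ μ₁ c ε =
      ((ε * dualValue (supportMeasure μ₀) (supportMeasure μ₁) k : ℝ) : EReal) := by
  obtain ⟨φ₀, φ₁, hφ⟩ := exists_isEOTPotentials (μ₀ := μ₀) (μ₁ := μ₁) hc hε.ne'
  rw [eotCost_eq (isCompact_iff_compactSpace.2 inferInstance)
    (isCompact_iff_compactSpace.2 inferInstance) hc hε hφ,
    dualValue_eq (marginals_gibbs_restrictPotentials hk hφ), ← integral_supportMeasure μ₀,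
    ← integral_supportMeasure μ₁]
  simp [restrictPotentials, integralL_apply, integral_div, ← add_div, mul_div_cancel₀ _ hε.ne']

theorem integral_gibbsCoupling_eq_optimalDensity (hc : Continuous (Function.uncurry c))
    (hk : ∀ z, k z = -(c z.1 z.2) / ε) (hφ : IsEOTPotentials μ₀ μ₁ c ε φ₀ φ₁) (f : X × Y → ℝ) :
    ∫ z, f z ∂gibbsCoupling μ₀ μ₁ c ε φ₀ φ₁ =
      ∫ z, optimalDensity (supportMeasure μ₀) (supportMeasure μ₁) k z * f (z.1, z.2)
        ∂(supportMeasure μ₀).prod (supportMeasure μ₁) := by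
  rw [integral_gibbsCoupling (isCompact_iff_compactSpace.2 inferInstance)
    (isCompact_iff_compactSpace.2 inferInstance) hc hφ, ← integral_prod_supportMeasure,
    ← gibbs_eq_optimalDensity (marginals_gibbs_restrictPotentials hk hφ)]
  simp only [gibbs_restrictPotentials hk]

end Restriction

section Frobenius

variable {m n : ℕ}

/-- The Frobenius inner product, as a continuous bilinear map. -/
def traceForm (m n : ℕ) : Matrix (Fin m) (Fin n) ℝ →L[ℝ] Matrix (Fin m) (Fin n) ℝ →L[ℝ] ℝ :=
  (LinearMap.mk₂ ℝ (fun A B : Matrix (Fin m) (Fin n) ℝ => (Aᵀ * B).trace)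
    (fun A A' B => by simp [Matrix.add_mul]) (fun c A B => by simp)
    (fun A B B' => by simp [Matrix.mul_add]) (fun c A B => by simp)).toContinuousBilinearMap

theorem traceForm_apply (A B : Matrix (Fin m) (Fin n) ℝ) :
    traceForm m n A B = (Aᵀ * B).trace := rfl

theorem traceForm_comm (A B : Matrix (Fin m) (Fin n) ℝ) :
    traceForm m n A B = traceForm m n B A := by
  rw [traceForm_apply, traceForm_apply, ← Matrix.trace_transpose, Matrix.transpose_mul,
    Matrix.transpose_transpose]

theorem frobenius_norm_sq (A : Matrix (Fin m) (Fin n) ℝ) : ‖A‖ ^ 2 = traceForm m n A A := by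
  rw [traceForm_apply, Matrix.frobenius_norm_def, ← Real.sqrt_eq_rpow,
    Real.sq_sqrt (by positivity), Matrix.trace, Finset.sum_comm]
  simp [Matrix.mul_apply, sq]

theorem hasFDerivAt_frobenius_norm_sq (A : Matrix (Fin m) (Fin n) ℝ) :
    HasFDerivAt (fun A : Matrix (Fin m) (Fin n) ℝ => ‖A‖ ^ 2) ((2 : ℝ) • traceForm m n A) A := by
  simp only [frobenius_norm_sq]
  refine ((traceForm m n).hasFDerivAt_of_bilinear (hasFDerivAt_id A)
    (hasFDerivAt_id A)).congr_fderiv ?_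
  ext B
  change traceForm m n A B + traceForm m n B A = 2 * traceForm m n A B
  rw [traceForm_comm B A, two_mul]

theorem contDiff_frobenius_norm_sq {r : WithTop ℕ∞} :
    ContDiff ℝ r fun A : Matrix (Fin m) (Fin n) ℝ => ‖A‖ ^ 2 := by
  simp only [frobenius_norm_sq]
  exact (traceForm m n).contDiff.clm_apply contDiff_id

end Frobenius

section InnerProductCost

variable {d₀ d₁ : ℕ}

section Cost

variable (A B : Matrix (Fin d₀) (Fin d₁) ℝ)

theorem bilin_add (x : EuclideanSpace ℝ (Fin d₀)) (y : EuclideanSpace ℝ (Fin d₁)) :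
    bilin (A + B) x y = bilin A x y + bilin B x y := by
  simp [bilin, Matrix.add_mulVec]

theorem bilin_smul (r : ℝ) (x : EuclideanSpace ℝ (Fin d₀)) (y : EuclideanSpace ℝ (Fin d₁)) :
    bilin (r • A) x y = r * bilin A x y := by
  simp [bilin, Matrix.smul_mulVec]

theorem continuous_bilin : Continuous (Function.uncurry (bilin A)) := by
  unfold Function.uncurry bilin
  fun_prop

theorem continuous_costA : Continuous (Function.uncurry (costA A)) := by
  have := continuous_bilin A
  unfold Function.uncurry at this ⊢
  unfold costA
  fun_prop

end Cost

section Exponent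

variable (μ₀ : Measure (EuclideanSpace ℝ (Fin d₀))) (μ₁ : Measure (EuclideanSpace ℝ (Fin d₁)))
  (ε : ℝ) (A : Matrix (Fin d₀) (Fin d₁) ℝ)

/-- The exponent `-c_A / ε`, restricted to the supports. -/
def exponent : C(μ₀.support × μ₁.support, ℝ) :=
  ⟨fun z => -(costA A z.1 z.2) / ε, ((continuous_costA A).comp
    (continuous_subtype_val.prodMap continuous_subtype_val)).neg.div_const ε⟩

/-- The derivative `C ↦ 32 xᵀ C y / ε` of the exponent with respect to the matrix. -/
def exponentDeriv : Matrix (Fin d₀) (Fin d₁) ℝ →L[ℝ] C(μ₀.support × μ₁.support, ℝ) :=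
  LinearMap.toContinuousLinearMap (𝕜 := ℝ) (E := Matrix (Fin d₀) (Fin d₁) ℝ)
    { toFun := fun A => ⟨fun z => 32 / ε * bilin A z.1 z.2, continuous_const.mul
        ((continuous_bilin A).comp (continuous_subtype_val.prodMap continuous_subtype_val))⟩
      map_add' := fun A B => by
        ext z
        simp [bilin_add, mul_add]
      map_smul' := fun r A => by
        ext z
        simp [bilin_smul, mul_left_comm] }

theorem exponentDeriv_apply (z : μ₀.support × μ₁.support) :
    exponentDeriv μ₀ μ₁ ε A z = 32 / ε * bilin A z.1 z.2 := rfl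

theorem exponent_eq : exponent μ₀ μ₁ ε A = exponent μ₀ μ₁ ε 0 + exponentDeriv μ₀ μ₁ ε A := by
  ext z
  rw [ContinuousMap.add_apply, exponentDeriv_apply]
  simp only [exponent, ContinuousMap.coe_mk, costA, bilin, Matrix.zero_mulVec, dotProduct_zero]
  ring

variable [CompactSpace μ₀.support] [CompactSpace μ₁.support]

theorem hasFDerivAt_exponent : HasFDerivAt (exponent μ₀ μ₁ ε) (exponentDeriv μ₀ μ₁ ε) A := by
  rw [show exponent μ₀ μ₁ ε = _ from funext (exponent_eq μ₀ μ₁ ε)]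
  exact (exponentDeriv μ₀ μ₁ ε).hasFDerivAt.const_add _

theorem contDiff_exponent {r : WithTop ℕ∞} :
    ContDiff ℝ r (exponent μ₀ μ₁ ε : Matrix (Fin d₀) (Fin d₁) ℝ → _) := by
  rw [show exponent μ₀ μ₁ ε = _ from funext (exponent_eq μ₀ μ₁ ε)]
  exact contDiff_const.add (exponentDeriv μ₀ μ₁ ε).contDiff

variable [IsProbabilityMeasure μ₀] [IsProbabilityMeasure μ₁]

/-- The density of `π_A` with respect to `μ₀ ⊗ μ₁`, on the supports. -/
def couplingDensity (A : Matrix (Fin d₀) (Fin d₁) ℝ) : C(μ₀.support × μ₁.support, ℝ) :=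
  optimalDensity (supportMeasure μ₀) (supportMeasure μ₁) (exponent μ₀ μ₁ ε A)

theorem hasFDerivAt_couplingDensity :
    HasFDerivAt (couplingDensity μ₀ μ₁ ε)
      (fderiv ℝ (optimalDensity (supportMeasure μ₀) (supportMeasure μ₁)) (exponent μ₀ μ₁ ε A) ∘L
        exponentDeriv μ₀ μ₁ ε) A :=
  ((contDiff_optimalDensity _ _).differentiable (by simp) _).hasFDerivAt.comp A
    (hasFDerivAt_exponent μ₀ μ₁ ε A)

end Exponent

variable {μ₀ : Measure (EuclideanSpace ℝ (Fin d₀))} {μ₁ : Measure (EuclideanSpace ℝ (Fin d₁))}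
  [IsProbabilityMeasure μ₀] [IsProbabilityMeasure μ₁] [CompactSpace μ₀.support]
  [CompactSpace μ₁.support] {ε : ℝ} {A C : Matrix (Fin d₀) (Fin d₁) ℝ}

section Objective

theorem Phi_eq (hε : 0 < ε) (A : Matrix (Fin d₀) (Fin d₁) ℝ) :
    Phi μ₀ μ₁ ε A = 32 * ‖A‖ ^ 2 +
      ε * dualValue (supportMeasure μ₀) (supportMeasure μ₁) (exponent μ₀ μ₁ ε A) := by
  rw [Phi, eotCost_eq_dualValue (k := exponent μ₀ μ₁ ε A) (continuous_costA A) hε fun _ => rfl,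
    EReal.toReal_coe]

theorem contDiff_Phi (hε : 0 < ε) : ContDiff ℝ ∞ (Phi μ₀ μ₁ ε) := by
  rw [funext (Phi_eq hε)]
  exact (contDiff_const.mul contDiff_frobenius_norm_sq).add
    (contDiff_const.mul ((contDiff_dualValue _ _).comp (contDiff_exponent μ₀ μ₁ ε)))

theorem fderiv_Phi_apply (hε : 0 < ε) (A B : Matrix (Fin d₀) (Fin d₁) ℝ) :
    fderiv ℝ (Phi μ₀ μ₁ ε) A B = 64 * traceForm d₀ d₁ A B -
      ε * integralL ((supportMeasure μ₀).prod (supportMeasure μ₁))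
        (couplingDensity μ₀ μ₁ ε A * exponentDeriv μ₀ μ₁ ε B) := by
  have hdual : HasFDerivAt (dualValue (supportMeasure μ₀) (supportMeasure μ₁)) _
      (exponent μ₀ μ₁ ε A) := ((contDiff_dualValue _ _).differentiable (by simp) _).hasFDerivAt
  have hderiv := ((hasFDerivAt_frobenius_norm_sq A).const_mul 32).add
    ((hdual.comp A (hasFDerivAt_exponent μ₀ μ₁ ε A)).const_mul ε)
  refine (DFunLike.congr_fun (hderiv.congr_of_eventuallyEq (.of_forall (Phi_eq hε))).fderiv
    B).trans ?_
  change 32 * (2 * traceForm d₀ d₁ A B) + ε * fderiv ℝ (dualValue (supportMeasure μ₀)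
    (supportMeasure μ₁)) (exponent μ₀ μ₁ ε A) (exponentDeriv μ₀ μ₁ ε B) = _
  rw [fderiv_dualValue_apply]
  simp only [couplingDensity]
  ring

/-- By symmetry of the second derivative, only the first derivative in the fixed direction `B` has
to be differentiated. -/
theorem fderiv_fderiv_Phi_apply (hε : 0 < ε) {h : C(μ₀.support, ℝ) × C(μ₁.support, ℝ)}
    (hh : marginals (supportMeasure μ₀) (supportMeasure μ₁)
      (couplingDensity μ₀ μ₁ ε A * (directSum h + exponentDeriv μ₀ μ₁ ε C)) = 0)
    (B : Matrix (Fin d₀) (Fin d₁) ℝ) :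
    fderiv ℝ (fderiv ℝ (Phi μ₀ μ₁ ε)) A B C = 64 * traceForm d₀ d₁ B C -
      ε * integralL ((supportMeasure μ₀).prod (supportMeasure μ₁))
        (couplingDensity μ₀ μ₁ ε A * (directSum h + exponentDeriv μ₀ μ₁ ε C) *
          exponentDeriv μ₀ μ₁ ε B) := by
  have hsmooth : ContDiff ℝ 2 (Phi μ₀ μ₁ ε) :=
    (contDiff_Phi hε).of_le (WithTop.coe_le_coe.2 le_top)
  have hsymm : IsSymmSndFDerivAt ℝ (Phi μ₀ μ₁ ε) A := hsmooth.contDiffAt.isSymmSndFDerivAt (by simp)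
  have hfderiv : HasFDerivAt (fderiv ℝ (Phi μ₀ μ₁ ε)) _ A :=
    ((hsmooth.fderiv_right (m := 1) le_rfl).differentiable one_ne_zero A).hasFDerivAt
  have happly := (ContinuousLinearMap.apply ℝ ℝ B).hasFDerivAt.comp A hfderiv
  have hexplicit := (((traceForm d₀ d₁).flip B).hasFDerivAt (x := A)).const_mul 64 |>.sub
    (((integralL ((supportMeasure μ₀).prod (supportMeasure μ₁))).hasFDerivAt.comp A
      ((hasFDerivAt_couplingDensity μ₀ μ₁ ε A).mul_const' (exponentDeriv μ₀ μ₁ ε B))).const_mul ε)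
  refine (hsymm.eq B C).trans ((DFunLike.congr_fun (happly.unique
    (hexplicit.congr_of_eventuallyEq (.of_forall fun A => fderiv_Phi_apply hε A B))) C).trans ?_)
  have hdensity : fderiv ℝ (optimalDensity _ _) _ _ =
      couplingDensity μ₀ μ₁ ε A * (directSum h + exponentDeriv μ₀ μ₁ ε C) :=
    fderiv_optimalDensity_apply hh
  rw [traceForm_comm B C, ← hdensity]
  rfl

theorem tendsto_Phi (hε : 0 < ε) :
    Tendsto (Phi μ₀ μ₁ ε) (comap (fun A : Matrix (Fin d₀) (Fin d₁) ℝ => ‖A‖) atTop) atTop := by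
  set V := dualValue (supportMeasure μ₀) (supportMeasure μ₁)
  obtain ⟨M, hM⟩ : ∃ M, ∀ A, ‖exponentDeriv μ₀ μ₁ ε A‖ ≤ M * ‖A‖ :=
    ⟨_, (exponentDeriv μ₀ μ₁ ε).le_opNorm⟩
  have hquadratic : Tendsto (fun t : ℝ => t * (32 * t - ε * M) + ε * V (exponent μ₀ μ₁ ε 0))
      atTop atTop :=
    tendsto_atTop_add_const_right _ _ (tendsto_id.atTop_mul_atTop₀
      (tendsto_atTop_add_const_right _ _ (tendsto_id.const_mul_atTop (by norm_num))))
  refine tendsto_atTop_mono (fun A => ?_) (hquadratic.comp tendsto_comap)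
  have hlip := (lipschitzWith_dualValue (supportMeasure μ₀) (supportMeasure μ₁)).dist_le_mul
    (exponent μ₀ μ₁ ε 0) (exponent μ₀ μ₁ ε A)
  rw [exponent_eq μ₀ μ₁ ε A, dist_self_add_right, NNReal.coe_one, one_mul, ← exponent_eq] at hlip
  have hV : V (exponent μ₀ μ₁ ε 0) - M * ‖A‖ ≤ V (exponent μ₀ μ₁ ε A) :=
    sub_le_comm.1 ((le_abs_self _).trans (hlip.trans (hM A)))
  rw [Phi_eq hε, Function.comp_apply]
  linarith [mul_le_mul_of_nonneg_left hV hε.le]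

end Objective

section LinearizedSystem

variable {φ₀ h₀ h₀' : EuclideanSpace ℝ (Fin d₀) → ℝ} {φ₁ h₁ h₁' : EuclideanSpace ℝ (Fin d₁) → ℝ}
  {h : C(μ₀.support, ℝ) × C(μ₁.support, ℝ)}

theorem couplingDensity_eq_exp (hφ : IsEOTPotentials μ₀ μ₁ (costA A) ε φ₀ φ₁)
    (z : μ₀.support × μ₁.support) :
    couplingDensity μ₀ μ₁ ε A z = Real.exp ((φ₀ z.1 + φ₁ z.2 - costA A z.1 z.2) / ε) := by
  rw [couplingDensity,
    ← gibbs_eq_optimalDensity (marginals_gibbs_restrictPotentials (fun _ => rfl) hφ)]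
  exact gibbs_restrictPotentials (fun _ => rfl) hφ z

theorem linearized_integrand_eq (hε : ε ≠ 0) (hφ : IsEOTPotentials μ₀ μ₁ (costA A) ε φ₀ φ₁)
    (e₀ : ∀ x : μ₀.support, h₀ x = -ε * h.1 x) (e₁ : ∀ y : μ₁.support, h₁ y = -ε * h.2 y)
    (z : μ₀.support × μ₁.support) :
    (h₀ z.1 + h₁ z.2 - 32 * bilin C z.1 z.2) *
        Real.exp ((φ₀ z.1 + φ₁ z.2 - costA A z.1 z.2) / ε) =
      -ε * (couplingDensity μ₀ μ₁ ε A * (directSum h + exponentDeriv μ₀ μ₁ ε C)) z := by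
  rw [ContinuousMap.mul_apply, couplingDensity_eq_exp hφ, ContinuousMap.add_apply,
    directSum_apply, exponentDeriv_apply, e₀, e₁]
  field_simp
  ring

/-- Solutions in the normalization of the exponent `-c_A / ε` are those of the linearized system
divided by `-ε`. -/
theorem isLinearizedSolution_iff (hε : ε ≠ 0) (hφ : IsEOTPotentials μ₀ μ₁ (costA A) ε φ₀ φ₁)
    (e₀ : ∀ x : μ₀.support, h₀ x = -ε * h.1 x) (e₁ : ∀ y : μ₁.support, h₁ y = -ε * h.2 y) :
    IsLinearizedSolution μ₀ μ₁ ε A C φ₀ φ₁ h₀ h₁ ↔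
      marginals (supportMeasure μ₀) (supportMeasure μ₁)
        (couplingDensity μ₀ μ₁ ε A * (directSum h + exponentDeriv μ₀ μ₁ ε C)) = 0 := by
  set f := couplingDensity μ₀ μ₁ ε A * (directSum h + exponentDeriv μ₀ μ₁ ε C)
  have hfst (x : μ₀.support) : ∫ y, (h₀ x + h₁ y - 32 * bilin C x y) *
      Real.exp ((φ₀ x + φ₁ y - costA A x y) / ε) ∂μ₁ =
        -ε * (marginals (supportMeasure μ₀) (supportMeasure μ₁) f).1 x := by
    rw [← integral_supportMeasure, marginals_fst_apply, ← integral_const_mul]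
    exact integral_congr_ae (ae_of_all _ fun y => linearized_integrand_eq hε hφ e₀ e₁ (x, y))
  have hsnd (y : μ₁.support) : ∫ x, (h₀ x + h₁ y - 32 * bilin C x y) *
      Real.exp ((φ₀ x + φ₁ y - costA A x y) / ε) ∂μ₀ =
        -ε * (marginals (supportMeasure μ₀) (supportMeasure μ₁) f).2 y := by
    rw [← integral_supportMeasure, marginals_snd_apply, ← integral_const_mul]
    exact integral_congr_ae (ae_of_all _ fun x => linearized_integrand_eq hε hφ e₀ e₁ (x, y))
  have hne : -ε ≠ 0 := neg_ne_zero.2 hε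
  constructor
  · intro hs
    refine Prod.ext (ContinuousMap.ext fun x => ?_) (ContinuousMap.ext fun y => ?_)
    · exact (mul_eq_zero_iff_left hne).1 ((hfst x).symm.trans (hs.system_fst x x.2))
    · exact (mul_eq_zero_iff_left hne).1 ((hsnd y).symm.trans (hs.system_snd y y.2))
  · intro hf
    refine ⟨continuousOn_iff_continuous_domRestrict.2 ?_,
      continuousOn_iff_continuous_domRestrict.2 ?_, fun x hx => ?_, fun y hy => ?_⟩
    · exact (continuous_const.mul h.1.continuous).congr fun x => (e₀ x).symm
    · exact (continuous_const.mul h.2.continuous).congr fun y => (e₁ y).symm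
    · simpa [hf] using hfst ⟨x, hx⟩
    · simpa [hf] using hsnd ⟨y, hy⟩

theorem _root_.IsLinearizedSolution.exists_restrict (hε : ε ≠ 0)
    (hφ : IsEOTPotentials μ₀ μ₁ (costA A) ε φ₀ φ₁)
    (hs : IsLinearizedSolution μ₀ μ₁ ε A C φ₀ φ₁ h₀ h₁) :
    ∃ h : C(μ₀.support, ℝ) × C(μ₁.support, ℝ),
      marginals (supportMeasure μ₀) (supportMeasure μ₁)
        (couplingDensity μ₀ μ₁ ε A * (directSum h + exponentDeriv μ₀ μ₁ ε C)) = 0 ∧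
      (∀ x : μ₀.support, h₀ x = -ε * h.1 x) ∧ ∀ y : μ₁.support, h₁ y = -ε * h.2 y := by
  let h : C(μ₀.support, ℝ) × C(μ₁.support, ℝ) :=
    (⟨fun x => h₀ x / -ε, hs.continuousOn_fst.domRestrict.div_const _⟩,
      ⟨fun y => h₁ y / -ε, hs.continuousOn_snd.domRestrict.div_const _⟩)
  have e₀ (x : μ₀.support) : h₀ x = -ε * h.1 x := (mul_div_cancel₀ _ (neg_ne_zero.2 hε)).symm
  have e₁ (y : μ₁.support) : h₁ y = -ε * h.2 y := (mul_div_cancel₀ _ (neg_ne_zero.2 hε)).symm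
  exact ⟨h, (isLinearizedSolution_iff hε hφ e₀ e₁).1 hs, e₀, e₁⟩

theorem exists_isLinearizedSolution (hε : ε ≠ 0)
    (hφ : IsEOTPotentials μ₀ μ₁ (costA A) ε φ₀ φ₁) (C : Matrix (Fin d₀) (Fin d₁) ℝ) :
    ∃ h₀ h₁, IsLinearizedSolution μ₀ μ₁ ε A C φ₀ φ₁ h₀ h₁ := by
  obtain ⟨h, hh⟩ := exists_marginals_gibbs_mul_eq_zero
    (marginals_optimalDensity (supportMeasure μ₀) (supportMeasure μ₁) (exponent μ₀ μ₁ ε A))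
    (exponentDeriv μ₀ μ₁ ε C)
  exact ⟨Function.extend Subtype.val (fun x => -ε * h.1 x) 0,
    Function.extend Subtype.val (fun y => -ε * h.2 y) 0,
    (isLinearizedSolution_iff hε hφ (Subtype.val_injective.extend_apply _ _)
      (Subtype.val_injective.extend_apply _ _)).2 hh⟩

theorem _root_.IsLinearizedSolution.unique (hε : ε ≠ 0)
    (hφ : IsEOTPotentials μ₀ μ₁ (costA A) ε φ₀ φ₁)
    (hs : IsLinearizedSolution μ₀ μ₁ ε A C φ₀ φ₁ h₀ h₁)
    (hs' : IsLinearizedSolution μ₀ μ₁ ε A C φ₀ φ₁ h₀' h₁') :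
    ∃ a : ℝ, (∀ x ∈ μ₀.support, h₀' x = h₀ x + a) ∧ ∀ y ∈ μ₁.support, h₁' y = h₁ y - a := by
  obtain ⟨h, hh, e₀, e₁⟩ := hs.exists_restrict hε hφ
  obtain ⟨h', hh', e₀', e₁'⟩ := hs'.exists_restrict hε hφ
  have hdiff : marginals (supportMeasure μ₀) (supportMeasure μ₁)
      (couplingDensity μ₀ μ₁ ε A * directSum (h' - h)) = 0 := by
    rw [map_sub, ← add_sub_add_right_eq_sub _ _ (exponentDeriv μ₀ μ₁ ε C), mul_sub, map_sub, hh,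
      hh', sub_zero]
  obtain ⟨a, ha⟩ := exists_eq_const_of_marginals_gibbs_mul_eq_zero
    (marginals_optimalDensity _ _ _) hdiff
  rw [sub_eq_iff_eq_add] at ha
  refine ⟨-ε * a, fun x hx => ?_, fun y hy => ?_⟩
  · rw [e₀ ⟨x, hx⟩, e₀' ⟨x, hx⟩, ha]
    simp only [Prod.fst_add, ContinuousMap.add_apply, ContinuousMap.smul_apply,
      ContinuousMap.one_apply, smul_eq_mul]
    ring
  · rw [e₁ ⟨y, hy⟩, e₁' ⟨y, hy⟩, ha]
    simp only [Prod.snd_add, ContinuousMap.add_apply, ContinuousMap.smul_apply,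
      ContinuousMap.one_apply, smul_eq_mul]
    ring

end LinearizedSystem

section OptimalCoupling

variable {π : Measure (EuclideanSpace ℝ (Fin d₀) × EuclideanSpace ℝ (Fin d₁))}

theorem toReal_eotCost (hε : 0 < ε) (A : Matrix (Fin d₀) (Fin d₁) ℝ) :
    ((eotCost μ₀ μ₁ (costA A) ε).toReal : EReal) = eotCost μ₀ μ₁ (costA A) ε := by
  rw [eotCost_eq_dualValue (k := exponent μ₀ μ₁ ε A) (continuous_costA A) hε fun _ => rfl,
    EReal.toReal_coe]

theorem existsUnique_isEOTCoupling (hε : 0 < ε) (A : Matrix (Fin d₀) (Fin d₁) ℝ) :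
    ∃! π, IsEOTCoupling μ₀ μ₁ (costA A) ε π := by
  obtain ⟨φ₀, φ₁, hφ⟩ := exists_isEOTPotentials (μ₀ := μ₀) (μ₁ := μ₁) (continuous_costA A) hε.ne'
  simp only [isEOTCoupling_iff (isCompact_iff_compactSpace.2 inferInstance)
    (isCompact_iff_compactSpace.2 inferInstance) (continuous_costA A) hε hφ]
  exact existsUnique_eq

theorem _root_.IsEOTCoupling.integral_eq (hε : 0 < ε) (hπ : IsEOTCoupling μ₀ μ₁ (costA A) ε π)
    (f : EuclideanSpace ℝ (Fin d₀) × EuclideanSpace ℝ (Fin d₁) → ℝ) :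
    ∫ z, f z ∂π = ∫ z, couplingDensity μ₀ μ₁ ε A z * f (z.1, z.2)
      ∂(supportMeasure μ₀).prod (supportMeasure μ₁) := by
  obtain ⟨φ₀, φ₁, hφ⟩ := exists_isEOTPotentials (μ₀ := μ₀) (μ₁ := μ₁) (continuous_costA A) hε.ne'
  rw [(isEOTCoupling_iff (isCompact_iff_compactSpace.2 inferInstance)
    (isCompact_iff_compactSpace.2 inferInstance) (continuous_costA A) hε hφ).1 hπ]
  exact integral_gibbsCoupling_eq_optimalDensity (continuous_costA A) (fun _ => rfl) hφ f

theorem _root_.IsEOTCoupling.fderiv_Phi_apply (hε : 0 < ε)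
    (hπ : IsEOTCoupling μ₀ μ₁ (costA A) ε π) (B : Matrix (Fin d₀) (Fin d₁) ℝ) :
    fderiv ℝ (Phi μ₀ μ₁ ε) A B = 64 * (Aᵀ * B).trace - 32 * ∫ z, bilin B z.1 z.2 ∂π := by
  rw [EntropicTransport.fderiv_Phi_apply hε, traceForm_apply, hπ.integral_eq hε, integralL_apply,
    ← integral_const_mul, ← integral_const_mul]
  congr 2
  ext z
  rw [ContinuousMap.mul_apply, exponentDeriv_apply]
  field_simp

theorem _root_.IsEOTCoupling.fderiv_fderiv_Phi_apply (hε : 0 < ε)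
    (hπ : IsEOTCoupling μ₀ μ₁ (costA A) ε π) {φ₀ h₀ : EuclideanSpace ℝ (Fin d₀) → ℝ}
    {φ₁ h₁ : EuclideanSpace ℝ (Fin d₁) → ℝ} (hφ : IsEOTPotentials μ₀ μ₁ (costA A) ε φ₀ φ₁)
    (hs : IsLinearizedSolution μ₀ μ₁ ε A C φ₀ φ₁ h₀ h₁) (B : Matrix (Fin d₀) (Fin d₁) ℝ) :
    fderiv ℝ (fderiv ℝ (Phi μ₀ μ₁ ε)) A B C = 64 * (Bᵀ * C).trace +
      32 * ε⁻¹ * ∫ z, bilin B z.1 z.2 * (h₀ z.1 + h₁ z.2 - 32 * bilin C z.1 z.2) ∂π := by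
  obtain ⟨h, hh, e₀, e₁⟩ := hs.exists_restrict hε.ne' hφ
  rw [EntropicTransport.fderiv_fderiv_Phi_apply hε hh, traceForm_apply, hπ.integral_eq hε,
    integralL_apply, sub_eq_add_neg, ← integral_const_mul, ← integral_const_mul, ← integral_neg]
  congr 2
  ext z
  simp only [ContinuousMap.mul_apply, ContinuousMap.add_apply, directSum_apply,
    exponentDeriv_apply, e₀, e₁]
  field_simp
  ring

end OptimalCoupling

end InnerProductCost

end

end EntropicTransport

open EntropicTransport in
theorem proposition2 {d₀ d₁ : ℕ}
    (μ₀ : Measure (EuclideanSpace ℝ (Fin d₀))) (μ₁ : Measure (EuclideanSpace ℝ (Fin d₁)))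
    [IsProbabilityMeasure μ₀] [IsProbabilityMeasure μ₁]
    (hμ₀ : IsCompact μ₀.support) (hμ₁ : IsCompact μ₁.support)
    (ε : ℝ) (hε : 0 < ε) :
    -- the EOT cost is finite, so that `Phi` is the objective of the variational problem
    (∀ A : Matrix (Fin d₀) (Fin d₁) ℝ,
      ((eotCost μ₀ μ₁ (costA A) ε).toReal : EReal) = eotCost μ₀ μ₁ (costA A) ε) ∧
    -- smoothness and coercivity
    ContDiff ℝ ∞ (Phi μ₀ μ₁ ε : Matrix (Fin d₀) (Fin d₁) ℝ → ℝ) ∧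
    Tendsto (Phi μ₀ μ₁ ε)
      (comap (fun A : Matrix (Fin d₀) (Fin d₁) ℝ => ‖A‖) atTop) atTop ∧
    ∀ A : Matrix (Fin d₀) (Fin d₁) ℝ,
      -- existence and uniqueness of the EOT coupling, existence of EOT potentials
      (∃! π, IsEOTCoupling μ₀ μ₁ (costA A) ε π) ∧
      (∃ φ₀ φ₁, IsEOTPotentials μ₀ μ₁ (costA A) ε φ₀ φ₁) ∧
      ∀ π, IsEOTCoupling μ₀ μ₁ (costA A) ε π →
        -- the first derivative
        (∀ B : Matrix (Fin d₀) (Fin d₁) ℝ,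
          fderiv ℝ (Phi μ₀ μ₁ ε) A B =
            64 * (Aᵀ * B).trace - 32 * ∫ z, bilin B z.1 z.2 ∂π) ∧
        ∀ φ₀ φ₁, IsEOTPotentials μ₀ μ₁ (costA A) ε φ₀ φ₁ →
          ∀ C : Matrix (Fin d₀) (Fin d₁) ℝ,
            -- the linearized system has a solution, unique up to additive constants
            (∃ h₀ h₁, IsLinearizedSolution μ₀ μ₁ ε A C φ₀ φ₁ h₀ h₁) ∧
            (∀ h₀ h₁ k₀ k₁, IsLinearizedSolution μ₀ μ₁ ε A C φ₀ φ₁ h₀ h₁ →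
              IsLinearizedSolution μ₀ μ₁ ε A C φ₀ φ₁ k₀ k₁ →
              ∃ a : ℝ, (∀ x ∈ μ₀.support, k₀ x = h₀ x + a) ∧
                ∀ y ∈ μ₁.support, k₁ y = h₁ y - a) ∧
            -- the second derivative
            ∀ h₀ h₁, IsLinearizedSolution μ₀ μ₁ ε A C φ₀ φ₁ h₀ h₁ →
              ∀ B : Matrix (Fin d₀) (Fin d₁) ℝ,
                fderiv ℝ (fderiv ℝ (Phi μ₀ μ₁ ε)) A B C =
                  64 * (Bᵀ * C).trace +
                    32 * ε⁻¹ * ∫ z, bilin B z.1 z.2 *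
                      (h₀ z.1 + h₁ z.2 - 32 * bilin C z.1 z.2) ∂π := by
  have : CompactSpace μ₀.support := isCompact_iff_compactSpace.1 hμ₀
  have : CompactSpace μ₁.support := isCompact_iff_compactSpace.1 hμ₁
  refine ⟨toReal_eotCost hε, contDiff_Phi hε, tendsto_Phi hε, fun A => ?_⟩
  refine ⟨existsUnique_isEOTCoupling hε A, exists_isEOTPotentials (continuous_costA A) hε.ne',
    fun π hπ => ⟨hπ.fderiv_Phi_apply hε, fun φ₀ φ₁ hφ C => ?_⟩⟩
  exact ⟨exists_isLinearizedSolution hε.ne' hφ C, fun _ _ _ _ hh hk => hh.unique hε.ne' hφ hk,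
    fun _ _ hh B => hπ.fderiv_fderiv_Phi_apply hε hφ hh B⟩
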